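/- Fix a real number $\mu>\pi$ and write $\mathbb C^*=\mathbb C\setminus\{0\}$. For $\eta:\mathbb R^2\to[0,+\infty)$ set \[\mathcal W_\eta=\Big\{(z_1,z_2,z_3)\in\mathbb C\times\mathbb C^*\times\mathbb C^*:\ \big|z_1-e^{i\log|z_2z_3|^2}\big|^2<1-\eta(\log|z_2|^2,\log|z_3|^2)\Big\}.\] Call $\eta$ admissible (for $\mu$) if it is upper semicontinuous, vanishes on the square $(-\mu,\mu)\times(-\mu,\mu)$, and $\eta^{-1}([0,1))$ is path-connected. For $\nu>0$ let $\mathcal W'_\nu$ be the set $\mathcal W_\eta$ with $\eta$ the characteristic function of $\mathbb R^2\setminus\big((-\nu,\nu)\times(-\nu,\nu)\big)$. Let $\mathscr C_\mu$ be the class of all $\mathcal W_\eta$ with $\eta=\eta(t_2,t_3)$ admissible such that: (I) $\eta$ is $C^\infty$ in an open neighborhood of $\eta^{-1}([0,1])$; (II) the gradient of $\eta$ does not vanish at any point of $\eta^{-1}(1)$; (III) $\eta^{-1}([0,1])$ is bounded; and the inequalities \[\eta+\eta''_{22}\ge0,\qquad \eta''_{22}\eta''_{33}-(\eta''_{23})^2+\eta\,(\eta''_{22}+\eta''_{33}-2\eta''_{23})-(\eta'_2-\eta'_3)^2\ge0,\]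 where $\eta'_j=\partial\eta/\partial t_j$ and $\eta''_{jk}=\partial^2\eta/\partial t_j\partial t_k$, hold at $(t_2,t_3)=(\log|z_2|^2,\log|z_3|^2)$ for all $z$ with $z_2z_3\ne0$ in a neighborhood of $\partial\mathcal W_\eta$. A domain is a nonempty connected open set; a smoothly bounded domain is a bounded domain with $C^\infty$ boundary; an open set is pseudoconvex if it admits a continuous plurisubharmonic exhaustion function. Theorem. Let $A_\pm>B_\pm\ge\sqrt{2e^\mu}$. For $c_\pm>0$ set $\eta:=\eta_++\eta_-$, where \[\eta_\pm(t_2,t_3):=\chi_{(B_\pm^2,+\infty)}(e^{\pm t_2}+e^{\pm t_3})\,\exp\left(\frac{c_\pm}{A_\pm^2-B_\pm^2}-\frac{c_\pm}{e^{\pm t_2}+e^{\pm t_3}-B_\pm^2}\right),\] the product being $0$ where the characteristic function $\chi_{(B_\pm^2,+\infty)}$ vanishes. Then: (a) for all $c_+,c_->0$, the function $\eta$ is admissible, $\mathcal W_\eta$ is a smoothly bounded domain in $\mathbb C^3$, $\mathcal W'_\mu\subseteq\mathcal W_\eta$, and $\mathcal W_\eta\subseteq\mathcal W'_{\mu'}$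 for every $\mu'\ge\max\{2\log A_+,2\log A_-\}$; (b) there exists $C_+\ge A_+^2$ such that for every $c_+>C_+$ there exists $C_-=C_-(c_+)\ge A_-^2$ such that for every $c_->C_-$ the domain $\mathcal W_\eta$ is pseudoconvex and belongs to $\mathscr C_\mu$. In particular, the class $\mathscr C_\mu$ is nonempty. -/

import Mathlib

open scoped ContDiff

noncomputable section

/-- A domain: a nonempty connected open subset of `ℂ³`. -/
def IsDomainC3 (Ω : Set (ℂ × ℂ × ℂ)) : Prop :=
  IsOpen Ω ∧ IsConnected Ω

/-- The boundary of `Ω` is smooth: near each boundary point `p` the set `Ω` is the sublevel set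
`{r < 0}` of a real-valued `C^∞` function `r` whose (real) differential at `p` is nonzero. -/
def HasSmoothBoundary (Ω : Set (ℂ × ℂ × ℂ)) : Prop :=
  ∀ p ∈ frontier Ω, ∃ (U : Set (ℂ × ℂ × ℂ)) (r : ℂ × ℂ × ℂ → ℝ),
    IsOpen U ∧ p ∈ U ∧ ContDiffOn ℝ ∞ r U ∧ fderiv ℝ r p ≠ 0 ∧ Ω ∩ U = {z ∈ U | r z < 0}

/-- A smoothly bounded domain: a bounded domain with smooth boundary. -/
def IsSmoothlyBoundedDomain (Ω : Set (ℂ × ℂ × ℂ)) : Prop :=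
  IsDomainC3 Ω ∧ Bornology.IsBounded Ω ∧ HasSmoothBoundary Ω

/-- A continuous real-valued function on the open set `Ω` is plurisubharmonic if it satisfies the
sub-mean value inequality on every closed complex affine disk contained in `Ω`. -/
def IsContinuousPsh (Ω : Set (ℂ × ℂ × ℂ)) (u : ℂ × ℂ × ℂ → ℝ) : Prop :=
  ContinuousOn u Ω ∧
    ∀ a v : ℂ × ℂ × ℂ, (∀ ζ : ℂ, ‖ζ‖ ≤ 1 → a + ζ • v ∈ Ω) →
      u a ≤ Real.circleAverage (fun ζ : ℂ => u (a + ζ • v)) 0 1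

/-- Pseudoconvexity of an open subset of `ℂ³`: there is a continuous plurisubharmonic exhaustion
function. -/
def IsPseudoconvex (Ω : Set (ℂ × ℂ × ℂ)) : Prop :=
  IsOpen Ω ∧ ∃ u : ℂ × ℂ × ℂ → ℝ, IsContinuousPsh Ω u ∧ ∀ c : ℝ, IsCompact {z ∈ Ω | u z ≤ c}

/-- The standing conditions on `η`, for a given `μ`: `η : ℝ² → [0, ∞)` is upper semicontinuous,
vanishes on the square `(-μ, μ) × (-μ, μ)`, and `η⁻¹([0, 1))` is path-connected. -/
structure IsWormProfile (μ : ℝ) (η : ℝ × ℝ → ℝ) : Prop where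
  nonneg : ∀ t, 0 ≤ η t
  upperSemicontinuous : UpperSemicontinuous η
  eq_zero : ∀ t ∈ Set.Ioo (-μ) μ ×ˢ Set.Ioo (-μ) μ, η t = 0
  isPathConnected : IsPathConnected (η ⁻¹' Set.Ico 0 1)

/-- The set `𝒲_η ⊆ ℂ × ℂ* × ℂ*`. -/
def wormDomain (η : ℝ × ℝ → ℝ) : Set (ℂ × ℂ × ℂ) :=
  {z | z.2.1 ≠ 0 ∧ z.2.2 ≠ 0 ∧
    ‖z.1 - Complex.exp (Complex.I * (Real.log (‖z.2.1 * z.2.2‖ ^ 2) : ℂ))‖ ^ 2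
      < 1 - η (Real.log (‖z.2.1‖ ^ 2), Real.log (‖z.2.2‖ ^ 2))}

/-- The truncated domain `𝒲'_μ`: the set `𝒲_η` for `η` the characteristic function of the
complement of the square `(-μ, μ) × (-μ, μ)`. -/
def truncatedWorm (μ : ℝ) : Set (ℂ × ℂ × ℂ) :=
  wormDomain (Set.indicator (Set.Ioo (-μ) μ ×ˢ Set.Ioo (-μ) μ)ᶜ (fun _ => (1 : ℝ)))

/-- The partial derivative `∂η/∂t₂`. -/
def partialTwo (η : ℝ × ℝ → ℝ) (t : ℝ × ℝ) : ℝ := fderiv ℝ η t (1, 0)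

/-- The partial derivative `∂η/∂t₃`. -/
def partialThree (η : ℝ × ℝ → ℝ) (t : ℝ × ℝ) : ℝ := fderiv ℝ η t (0, 1)

/-- (I): `η` is smooth in an open neighborhood of `η⁻¹([0, 1])`. -/
def WormSmooth (η : ℝ × ℝ → ℝ) : Prop :=
  ∃ U : Set (ℝ × ℝ), IsOpen U ∧ η ⁻¹' Set.Icc 0 1 ⊆ U ∧ ContDiffOn ℝ ∞ η U

/-- (II): the gradient of `η` does not vanish at any point of `η⁻¹(1)`. -/
def WormRegular (η : ℝ × ℝ → ℝ) : Prop :=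
  ∀ t, η t = 1 → fderiv ℝ η t ≠ 0

/-- (III): `η⁻¹([0, 1])` is bounded. -/
def WormBounded (η : ℝ × ℝ → ℝ) : Prop :=
  Bornology.IsBounded (η ⁻¹' Set.Icc 0 1)

/-- The first pseudoconvexity inequality at `t`: `η + η''₂₂ ≥ 0`. -/
def WormInequalityOne (η : ℝ × ℝ → ℝ) (t : ℝ × ℝ) : Prop :=
  0 ≤ η t + partialTwo (partialTwo η) t

/-- The second pseudoconvexity inequality at `t`:
`η''₂₂ η''₃₃ - (η''₂₃)² + η (η''₂₂ + η''₃₃ - 2 η''₂₃) - (η'₂ - η'₃)² ≥ 0`. -/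
def WormInequalityTwo (η : ℝ × ℝ → ℝ) (t : ℝ × ℝ) : Prop :=
  0 ≤ partialTwo (partialTwo η) t * partialThree (partialThree η) t
      - partialTwo (partialThree η) t ^ 2
      + η t * (partialTwo (partialTwo η) t + partialThree (partialThree η) t
          - 2 * partialTwo (partialThree η) t)
      - (partialTwo η t - partialThree η t) ^ 2

/-- The two inequalities hold at `(log |z₂|², log |z₃|²)` for all `z` with `z₂ z₃ ≠ 0` in a
neighborhood of the boundary of `𝒲_η`. -/
def WormInequalitiesNearBoundary (η : ℝ × ℝ → ℝ) : Prop :=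
  ∃ V : Set (ℂ × ℂ × ℂ), IsOpen V ∧ frontier (wormDomain η) ⊆ V ∧
    ∀ z ∈ V, z.2.1 ≠ 0 → z.2.2 ≠ 0 →
      WormInequalityOne η (Real.log (‖z.2.1‖ ^ 2), Real.log (‖z.2.2‖ ^ 2)) ∧
      WormInequalityTwo η (Real.log (‖z.2.1‖ ^ 2), Real.log (‖z.2.2‖ ^ 2))

/-- The class `𝒞_μ`. -/
def wormClass (μ : ℝ) : Set (Set (ℂ × ℂ × ℂ)) :=
  {Ω | ∃ η : ℝ × ℝ → ℝ, IsWormProfile μ η ∧ WormSmooth η ∧ WormRegular η ∧ WormBounded η ∧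
    WormInequalitiesNearBoundary η ∧ Ω = wormDomain η}

/-- The function `f_±`, where `s = ±1` is the sign:
`c / (A² - B²) - c / (e^{s t₂} + e^{s t₃} - B²)`. -/
def wormExponent (s A B c : ℝ) (t : ℝ × ℝ) : ℝ :=
  c / (A ^ 2 - B ^ 2) - c / (Real.exp (s * t.1) + Real.exp (s * t.2) - B ^ 2)

/-- The function `η_±`, where `s = ±1` is the sign:
`χ_{(B², ∞)}(e^{s t₂} + e^{s t₃}) · exp f_±(t₂, t₃)`. -/
def wormEtaSigned (s A B c : ℝ) (t : ℝ × ℝ) : ℝ :=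
  Set.indicator (Set.Ioi (B ^ 2)) (fun _ => (1 : ℝ)) (Real.exp (s * t.1) + Real.exp (s * t.2))
    * Real.exp (wormExponent s A B c t)

/-- The explicit function `η = η_+ + η_-`. -/
def wormEta (Ap Am Bp Bm cp cm : ℝ) (t : ℝ × ℝ) : ℝ :=
  wormEtaSigned 1 Ap Bp cp t + wormEtaSigned (-1) Am Bm cm t

end

noncomputable section

/-! ### Partial derivatives on the plane -/

/-! Put `z₂ = e^x`, `z₃ = e^y` and let `r = |z₁ - e^{i log |z₂z₃|²}|² - 1 + η` be the defining
function (`wormFn`). Multiplying `r` by the positive factor `e^{2 Im (x+y)}` gives `|z₁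
e^{-i(x+y)}|² - 2 Re (z₁ e^{-2i(x+y)}) + e^{2 Im (x+y)} η(2 Re x, 2 Re y)` (`exp_mul_wormFn`). The
first term is plurisubharmonic and the second pluriharmonic. The third is plurisubharmonic where a
Hermitian 2×2 matrix built from `η` is positive semidefinite (`LeviNonneg`, `twistedDD_add_nonneg`).
The factor depends on the branches of the logarithms, but its logarithm is pluriharmonic, so
`-log(-r)` is a globally defined plurisubharmonic function (`isContinuousPsh_wormPotential`). It is
an exhaustion because `{η < 1}` is bounded, which keeps the domain bounded and away from `z₂z₃ = 0`.

The class inequalities are the (1,1) entry and the determinant of the same matrix. Positive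
semidefinite matrices add, so `η₊` and `η₋` can be treated separately. Each is a function `φ` of `S
= e^{s t₂} + e^{s t₃}` with `φ' = φp`, `φ'' = φ(p² - q)`, `p = c/(S - B²)²`, `q = 2c/(S - B²)³`,
where `S > B²`. On a bounded region `p² - q` and the determinant are nonnegative once `c` is large
(`levi_det_ineq`, `leviNonneg_radialProfile`). The bound on one exponential sum supplies the lower
bounds on the exponentials in the other, so each threshold for `c` depends on `A₊` and `A₋` only.

Part (a) is geometric. Since `B² ≥ 2`, convexity of `exp` makes `{η < 1}` star-shaped about the
origin and makes the radial derivative of `η` positive wherever `η > 0`. This gives connectedness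
and regularity of the level `η = 1`, hence a connected domain with smooth boundary. -/

lemma hasDerivAt_comp_prod {f : ℝ × ℝ → ℝ} {x y : ℝ → ℝ} {x' y' s : ℝ}
    (hf : DifferentiableAt ℝ f (x s, y s)) (hx : HasDerivAt x x' s) (hy : HasDerivAt y y' s) :
    HasDerivAt (fun s => f (x s, y s))
      (partialTwo f (x s, y s) * x' + partialThree f (x s, y s) * y') s := by
  have h := hf.hasFDerivAt.comp_hasDerivAt s (hx.prodMk hy)
  have e : ((x', y') : ℝ × ℝ) = x' • (1, 0) + y' • (0, 1) := by simp
  rw [e, map_add, map_smul, map_smul] at h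
  refine h.congr_deriv ?_
  simp [partialTwo, partialThree, mul_comm]

lemma fderiv_apply_eq_partial (f : ℝ × ℝ → ℝ) (t v : ℝ × ℝ) :
    fderiv ℝ f t v = partialTwo f t * v.1 + partialThree f t * v.2 := by
  have : v = v.1 • ((1, 0) : ℝ × ℝ) + v.2 • ((0, 1) : ℝ × ℝ) := by simp
  conv_lhs => rw [this, map_add, map_smul, map_smul]
  simp [partialTwo, partialThree, mul_comm]

lemma partialTwo_eq_of_hasDerivAt {f : ℝ × ℝ → ℝ} {t : ℝ × ℝ} {d : ℝ}
    (hf : DifferentiableAt ℝ f t) (h : HasDerivAt (fun x => f (x, t.2)) d t.1) :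
    partialTwo f t = d := by
  have := hasDerivAt_comp_prod (x := id) (y := fun _ => t.2) (s := t.1) hf
    (hasDerivAt_id _) (hasDerivAt_const _ _)
  simpa using this.unique h

lemma partialThree_eq_of_hasDerivAt {f : ℝ × ℝ → ℝ} {t : ℝ × ℝ} {d : ℝ}
    (hf : DifferentiableAt ℝ f t) (h : HasDerivAt (fun x => f (t.1, x)) d t.2) :
    partialThree f t = d := by
  have := hasDerivAt_comp_prod (x := fun _ => t.1) (y := id) (s := t.2) hf
    (hasDerivAt_const _ _) (hasDerivAt_id _)
  simpa using this.unique h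

lemma ContDiff.partialTwo {f : ℝ × ℝ → ℝ} (hf : ContDiff ℝ ∞ f) :
    ContDiff ℝ ∞ (partialTwo f) :=
  (hf.fderiv_right (m := ∞) (by simp)).clm_apply contDiff_const

lemma ContDiff.partialThree {f : ℝ × ℝ → ℝ} (hf : ContDiff ℝ ∞ f) :
    ContDiff ℝ ∞ (partialThree f) :=
  (hf.fderiv_right (m := ∞) (by simp)).clm_apply contDiff_const

lemma partialThree_partialTwo {f : ℝ × ℝ → ℝ} (hf : ContDiff ℝ ∞ f) (t : ℝ × ℝ) :
    partialThree (partialTwo f) t = partialTwo (partialThree f) t := by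
  have h2 : DifferentiableAt ℝ (fderiv ℝ f) t :=
    ((hf.fderiv_right (m := ∞) (by simp)).differentiable (by simp)) t
  have hs := (hf.contDiffAt (x := t)).isSymmSndFDerivAt (by
    simpa using WithTop.coe_le_coe.2 (le_top : (2 : ℕ∞) ≤ ⊤))
  have key : ∀ v w : ℝ × ℝ, fderiv ℝ (fun p => fderiv ℝ f p v) t w = fderiv ℝ (fderiv ℝ f) t w v := by
    intro v w
    rw [fderiv_clm_apply h2 (by fun_prop)]
    simp
  unfold partialThree partialTwo
  rw [key, key]
  exact hs _ _

lemma partialTwo_add {f g : ℝ × ℝ → ℝ} (hf : ContDiff ℝ ∞ f) (hg : ContDiff ℝ ∞ g) :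
    partialTwo (fun t => f t + g t) = fun t => partialTwo f t + partialTwo g t := by
  funext t
  simp only [partialTwo]
  rw [fderiv_fun_add ((hf.differentiable (by simp)) t) ((hg.differentiable (by simp)) t)]
  rfl

lemma partialThree_add {f g : ℝ × ℝ → ℝ} (hf : ContDiff ℝ ∞ f) (hg : ContDiff ℝ ∞ g) :
    partialThree (fun t => f t + g t) = fun t => partialThree f t + partialThree g t := by
  funext t
  simp only [partialThree]
  rw [fderiv_fun_add ((hf.differentiable (by simp)) t) ((hg.differentiable (by simp)) t)]
  rfl

/-! ### Derivatives of functions of the exponential sum. -/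

/-- The exponential sum `e^{s t₂} + e^{s t₃}`. -/
def expSum (s : ℝ) (t : ℝ × ℝ) : ℝ := Real.exp (s * t.1) + Real.exp (s * t.2)

lemma contDiff_expSum (s : ℝ) : ContDiff ℝ ∞ (expSum s) := by
  unfold expSum; fun_prop

lemma hasDerivAt_exp_mul (s x : ℝ) :
    HasDerivAt (fun x => Real.exp (s * x)) (s * Real.exp (s * x)) x := by
  have := ((hasDerivAt_id x).const_mul s).exp
  simpa [mul_comm] using this

lemma contDiff_comp_expSum {φ : ℝ → ℝ} (hφ : ContDiff ℝ ∞ φ) (s : ℝ) : ContDiff ℝ ∞ (fun t => φ (expSum s t)) :=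
  hφ.comp (contDiff_expSum s)

lemma partialTwo_comp_expSum {φ : ℝ → ℝ} (hφ : ContDiff ℝ ∞ φ)
    (s : ℝ) (t : ℝ × ℝ) :
    partialTwo (fun t => φ (expSum s t)) t = deriv φ (expSum s t) * (s * Real.exp (s * t.1)) := by
  refine partialTwo_eq_of_hasDerivAt ((contDiff_comp_expSum hφ s).differentiable (by simp) t) ?_
  have h1 := (hasDerivAt_exp_mul s t.1).add_const (Real.exp (s * t.2))
  exact HasDerivAt.comp (h := fun x => Real.exp (s * x) + Real.exp (s * t.2)) t.1
    ((hφ.differentiable (by simp)) (expSum s t)).hasDerivAt h1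

lemma partialThree_comp_expSum {φ : ℝ → ℝ} (hφ : ContDiff ℝ ∞ φ)
    (s : ℝ) (t : ℝ × ℝ) :
    partialThree (fun t => φ (expSum s t)) t = deriv φ (expSum s t) * (s * Real.exp (s * t.2)) := by
  refine partialThree_eq_of_hasDerivAt ((contDiff_comp_expSum hφ s).differentiable (by simp) t) ?_
  have h1 := (hasDerivAt_exp_mul s t.2).const_add (Real.exp (s * t.1))
  exact HasDerivAt.comp (h := fun x => Real.exp (s * t.1) + Real.exp (s * x)) t.2
    ((hφ.differentiable (by simp)) (expSum s t)).hasDerivAt h1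

lemma contDiff_deriv_top {φ : ℝ → ℝ} (hφ : ContDiff ℝ ∞ φ) : ContDiff ℝ ∞ (deriv φ) := by
  have := (contDiff_infty_iff_deriv (𝕜 := ℝ) (f := φ)).1 hφ
  exact this.2

lemma partialTwo_partialTwo_comp_expSum {φ : ℝ → ℝ} (hφ : ContDiff ℝ ∞ φ)
    (s : ℝ) (t : ℝ × ℝ) :
    partialTwo (partialTwo (fun t => φ (expSum s t))) t =
      deriv (deriv φ) (expSum s t) * (s * Real.exp (s * t.1)) ^ 2
        + deriv φ (expSum s t) * (s ^ 2 * Real.exp (s * t.1)) := by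
  refine partialTwo_eq_of_hasDerivAt
    ((contDiff_comp_expSum hφ s).partialTwo.differentiable (by simp) t) ?_
  have h0 := hasDerivAt_exp_mul s t.1
  have h1 : HasDerivAt (fun x => deriv φ (expSum s (x, t.2)))
      (deriv (deriv φ) (expSum s t) * (s * Real.exp (s * t.1))) t.1 :=
    HasDerivAt.comp (h := fun x => Real.exp (s * x) + Real.exp (s * t.2)) t.1
      (((contDiff_deriv_top hφ).differentiable (by simp)) (expSum s t)).hasDerivAt
      (h0.add_const (Real.exp (s * t.2)))
  have h2 := h1.mul (h0.const_mul s)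
  refine (h2.congr_of_eventuallyEq (Filter.Eventually.of_forall fun x => ?_)).congr_deriv ?_
  · rw [partialTwo_comp_expSum hφ]; rfl
  · simp only [Prod.mk.eta]; ring

lemma partialThree_partialThree_comp_expSum {φ : ℝ → ℝ} (hφ : ContDiff ℝ ∞ φ)
    (s : ℝ) (t : ℝ × ℝ) :
    partialThree (partialThree (fun t => φ (expSum s t))) t =
      deriv (deriv φ) (expSum s t) * (s * Real.exp (s * t.2)) ^ 2
        + deriv φ (expSum s t) * (s ^ 2 * Real.exp (s * t.2)) := by
  refine partialThree_eq_of_hasDerivAt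
    ((contDiff_comp_expSum hφ s).partialThree.differentiable (by simp) t) ?_
  have h0 := hasDerivAt_exp_mul s t.2
  have h1 : HasDerivAt (fun x => deriv φ (expSum s (t.1, x)))
      (deriv (deriv φ) (expSum s t) * (s * Real.exp (s * t.2))) t.2 :=
    HasDerivAt.comp (h := fun x => Real.exp (s * t.1) + Real.exp (s * x)) t.2
      (((contDiff_deriv_top hφ).differentiable (by simp)) (expSum s t)).hasDerivAt
      (h0.const_add (Real.exp (s * t.1)))
  have h2 := h1.mul (h0.const_mul s)
  refine (h2.congr_of_eventuallyEq (Filter.Eventually.of_forall fun x => ?_)).congr_deriv ?_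
  · rw [partialThree_comp_expSum hφ]; rfl
  · simp only [Prod.mk.eta]; ring

lemma partialTwo_partialThree_comp_expSum {φ : ℝ → ℝ} (hφ : ContDiff ℝ ∞ φ)
    (s : ℝ) (t : ℝ × ℝ) :
    partialTwo (partialThree (fun t => φ (expSum s t))) t =
      deriv (deriv φ) (expSum s t) * (s * Real.exp (s * t.1)) * (s * Real.exp (s * t.2)) := by
  refine partialTwo_eq_of_hasDerivAt
    ((contDiff_comp_expSum hφ s).partialThree.differentiable (by simp) t) ?_
  have h0 := hasDerivAt_exp_mul s t.1
  have h1 : HasDerivAt (fun x => deriv φ (expSum s (x, t.2)))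
      (deriv (deriv φ) (expSum s t) * (s * Real.exp (s * t.1))) t.1 :=
    HasDerivAt.comp (h := fun x => Real.exp (s * x) + Real.exp (s * t.2)) t.1
      (((contDiff_deriv_top hφ).differentiable (by simp)) (expSum s t)).hasDerivAt
      (h0.add_const (Real.exp (s * t.2)))
  have h2 := h1.mul_const (s * Real.exp (s * t.2))
  refine h2.congr_of_eventuallyEq (Filter.Eventually.of_forall fun x => ?_)
  simp only [partialThree_comp_expSum hφ]

/-! ### The one-variable profile -/

/-- The one-variable profile: `wormEtaSigned s A B c = radialProfile A B c ∘ expSum s`. -/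
def radialProfile (A B c x : ℝ) : ℝ :=
  Real.exp (c / (A ^ 2 - B ^ 2)) * expNegInvGlue ((x - B ^ 2) / c)

lemma radialProfile_of_le {A B c x : ℝ} (hc : 0 < c) (hx : x ≤ B ^ 2) :
    radialProfile A B c x = 0 := by
  rw [radialProfile, expNegInvGlue.zero_of_nonpos, mul_zero]
  exact div_nonpos_of_nonpos_of_nonneg (by linarith) hc.le

lemma radialProfile_of_lt {A B c x : ℝ} (hc : 0 < c) (hx : B ^ 2 < x) :
    radialProfile A B c x = Real.exp (c / (A ^ 2 - B ^ 2) - c / (x - B ^ 2)) := by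
  have : ¬ (x - B ^ 2) / c ≤ 0 := not_le.2 (div_pos (by linarith) hc)
  rw [radialProfile, expNegInvGlue, if_neg this, ← Real.exp_add, inv_div, ← sub_eq_add_neg]

/-- Replaces the cut-off by `expNegInvGlue`, whose smoothness gives that of `η` across the curve
where the exponential sum equals `B²`. -/
lemma wormEtaSigned_eq {A B c : ℝ} (hc : 0 < c) (s : ℝ) :
    wormEtaSigned s A B c = fun t => radialProfile A B c (expSum s t) := by
  funext t
  rcases le_or_gt (expSum s t) (B ^ 2) with h | h
  · rw [radialProfile_of_le hc h, wormEtaSigned, Set.indicator_of_notMem, zero_mul]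
    exact not_lt.2 h
  · rw [radialProfile_of_lt hc h, wormEtaSigned, Set.indicator_of_mem, one_mul]
    · rfl
    · exact h

lemma contDiff_radialProfile (A B c : ℝ) : ContDiff ℝ ∞ (radialProfile A B c) := by
  unfold radialProfile
  exact contDiff_const.mul (expNegInvGlue.contDiff.comp (by fun_prop))

lemma radialProfile_nonneg (A B c x : ℝ) : 0 ≤ radialProfile A B c x :=
  mul_nonneg (Real.exp_pos _).le (expNegInvGlue.nonneg _)

lemma monotone_radialProfile (A B : ℝ) {c : ℝ} (hc : 0 < c) : Monotone (radialProfile A B c) := by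
  intro x y h
  exact mul_le_mul_of_nonneg_left
    (expNegInvGlue.monotone (div_le_div_of_nonneg_right (by linarith) hc.le)) (Real.exp_pos _).le

/-- The normalising factor `exp(c / (A² - B²))` places the level 1 exactly at `x = A²`, whatever `c`
is. -/
lemma radialProfile_lt_one_iff {A B c x : ℝ} (hc : 0 < c) (hAB : B ^ 2 < A ^ 2) :
    radialProfile A B c x < 1 ↔ x < A ^ 2 := by
  rcases le_or_gt x (B ^ 2) with h | h
  · rw [radialProfile_of_le hc h]
    exact iff_of_true one_pos (h.trans_lt hAB)
  · rw [radialProfile_of_lt hc h, Real.exp_lt_one_iff, sub_neg,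
      div_lt_div_iff_of_pos_left hc (by linarith) (by linarith)]
    constructor <;> intro <;> linarith

lemma radialProfile_le_one_iff {A B c x : ℝ} (hc : 0 < c) (hAB : B ^ 2 < A ^ 2) :
    radialProfile A B c x ≤ 1 ↔ x ≤ A ^ 2 := by
  rcases le_or_gt x (B ^ 2) with h | h
  · rw [radialProfile_of_le hc h]
    exact iff_of_true zero_le_one (h.trans hAB.le)
  · rw [radialProfile_of_lt hc h, Real.exp_le_one_iff, sub_nonpos,
      div_le_div_iff_of_pos_left hc (by linarith) (by linarith)]
    constructor <;> intro <;> linarith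

lemma hasDerivAt_radialProfile {A B c x : ℝ} (hc : 0 < c) (hx : B ^ 2 < x) :
    HasDerivAt (radialProfile A B c) (radialProfile A B c x * (c / (x - B ^ 2) ^ 2)) x := by
  have hx0 : x - B ^ 2 ≠ 0 := by linarith
  have h : HasDerivAt (fun x => Real.exp (c / (A ^ 2 - B ^ 2) - c / (x - B ^ 2)))
      (Real.exp (c / (A ^ 2 - B ^ 2) - c / (x - B ^ 2)) * (c / (x - B ^ 2) ^ 2)) x := by
    have h1 := ((hasDerivAt_const x c).div ((hasDerivAt_id x).sub_const (B ^ 2)) hx0).const_sub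
      (c / (A ^ 2 - B ^ 2))
    refine h1.exp.congr_deriv ?_
    simp only [id, Pi.div_apply]
    ring
  rw [radialProfile_of_lt hc hx]
  refine h.congr_of_eventuallyEq ?_
  filter_upwards [lt_mem_nhds hx] with y hy using radialProfile_of_lt hc hy

lemma deriv_radialProfile_of_lt {A B c x : ℝ} (hc : 0 < c) (hx : B ^ 2 < x) :
    deriv (radialProfile A B c) x = radialProfile A B c x * (c / (x - B ^ 2) ^ 2) :=
  (hasDerivAt_radialProfile hc hx).deriv

lemma deriv_radialProfile_pos {A B c x : ℝ} (hc : 0 < c) (hx : B ^ 2 < x) :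
    0 < deriv (radialProfile A B c) x := by
  rw [deriv_radialProfile_of_lt hc hx, radialProfile_of_lt hc hx]
  have : 0 < x - B ^ 2 := by linarith
  positivity

lemma deriv_radialProfile_nonneg (A B : ℝ) {c : ℝ} (hc : 0 < c) (x : ℝ) :
    0 ≤ deriv (radialProfile A B c) x :=
  (monotone_radialProfile A B hc).deriv_nonneg

lemma deriv_deriv_radialProfile_of_lt {A B c x : ℝ} (hc : 0 < c) (hx : B ^ 2 < x) :
    deriv (deriv (radialProfile A B c)) x =
      radialProfile A B c x * ((c / (x - B ^ 2) ^ 2) ^ 2 - 2 * c / (x - B ^ 2) ^ 3) := by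
  have hx0 : x - B ^ 2 ≠ 0 := by linarith
  have h1 := (hasDerivAt_const x c).div (((hasDerivAt_id x).sub_const (B ^ 2)).pow 2)
    (pow_ne_zero 2 hx0)
  have h := (hasDerivAt_radialProfile (A := A) hc hx).mul h1
  have h2 : HasDerivAt (deriv (radialProfile A B c)) _ x := h.congr_of_eventuallyEq (by
    filter_upwards [lt_mem_nhds hx] with y hy using deriv_radialProfile_of_lt hc hy)
  rw [h2.deriv]
  simp only [id, Pi.div_apply, Pi.pow_apply]
  field_simp
  ring

/-- A nonnegative function has a minimum at each of its zeros. This covers the gluing point `x = B²`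
without any limit of difference quotients, and the same argument applied to the nonnegative first
derivative handles the second. -/
lemma deriv_radialProfile_of_le {A B c x : ℝ} (hc : 0 < c) (hx : x ≤ B ^ 2) :
    deriv (radialProfile A B c) x = 0 := by
  refine IsLocalMin.deriv_eq_zero (Filter.Eventually.of_forall fun y => ?_)
  rw [radialProfile_of_le hc hx]
  exact radialProfile_nonneg _ _ _ _

lemma deriv_deriv_radialProfile_of_le {A B c x : ℝ} (hc : 0 < c) (hx : x ≤ B ^ 2) :
    deriv (deriv (radialProfile A B c)) x = 0 := by
  refine IsLocalMin.deriv_eq_zero (Filter.Eventually.of_forall fun y => ?_)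
  rw [deriv_radialProfile_of_le hc hx]
  exact deriv_radialProfile_nonneg _ _ hc _

/-! ### Positivity of the Levi matrix -/

/-- Positive semidefiniteness of the Hermitian matrix with rows
`(η''₂₂ + η, η''₂₃ + η + i (η'₂ - η'₃))` and `(η''₂₃ + η - i (η'₂ - η'₃), η''₃₃ + η)`. -/
def LeviNonneg (η : ℝ × ℝ → ℝ) (t : ℝ × ℝ) : Prop :=
  0 ≤ η t + partialTwo (partialTwo η) t ∧ 0 ≤ η t + partialThree (partialThree η) t ∧
    (partialTwo (partialThree η) t + η t) ^ 2 + (partialTwo η t - partialThree η t) ^ 2 ≤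
      (η t + partialTwo (partialTwo η) t) * (η t + partialThree (partialThree η) t)

lemma LeviNonneg.wormInequalityOne {η : ℝ × ℝ → ℝ} {t : ℝ × ℝ} (h : LeviNonneg η t) :
    WormInequalityOne η t := h.1

/-- Expanding the determinant of the Levi matrix, the terms `η²` cancel and the remaining expression
is the second inequality. -/
lemma LeviNonneg.wormInequalityTwo {η : ℝ × ℝ → ℝ} {t : ℝ × ℝ} (h : LeviNonneg η t) :
    WormInequalityTwo η t := by
  have := h.2.2
  unfold WormInequalityTwo
  nlinarith

/-- The determinant condition for a sum of two positive semidefinite Hermitian 2×2 matrices: the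
mixed term is bounded by Cauchy–Schwarz followed by the inequality of arithmetic and geometric
means. -/
lemma sq_add_sq_le_mul_add {a b d₁ d₂ a' b' d₁' d₂' : ℝ} (ha : 0 ≤ a) (hb : 0 ≤ b) (ha' : 0 ≤ a')
    (hb' : 0 ≤ b') (h : d₁ ^ 2 + d₂ ^ 2 ≤ a * b) (h' : d₁' ^ 2 + d₂' ^ 2 ≤ a' * b') :
    (d₁ + d₁') ^ 2 + (d₂ + d₂') ^ 2 ≤ (a + a') * (b + b') := by
  have h1 : (d₁ * d₁' + d₂ * d₂') ^ 2 ≤ (a * b) * (a' * b') := by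
    calc (d₁ * d₁' + d₂ * d₂') ^ 2 ≤ (d₁ ^ 2 + d₂ ^ 2) * (d₁' ^ 2 + d₂' ^ 2) := by
          nlinarith [sq_nonneg (d₁ * d₂' - d₂ * d₁')]
      _ ≤ _ := mul_le_mul h h' (by positivity) (by positivity)
  have h2 : (d₁ * d₁' + d₂ * d₂') * 2 ≤ a * b' + a' * b := by
    refine le_of_sq_le_sq ?_ (by positivity)
    nlinarith [sq_nonneg (a * b' - a' * b)]
  nlinarith

lemma LeviNonneg.add {f g : ℝ × ℝ → ℝ} {t : ℝ × ℝ} (hf : ContDiff ℝ ∞ f) (hg : ContDiff ℝ ∞ g)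
    (h : LeviNonneg f t) (h' : LeviNonneg g t) : LeviNonneg (fun t => f t + g t) t := by
  obtain ⟨h1, h2, h3⟩ := h
  obtain ⟨h1', h2', h3'⟩ := h'
  have := sq_add_sq_le_mul_add h1 h2 h1' h2' h3 h3'
  unfold LeviNonneg
  rw [partialTwo_add hf hg, partialThree_add hf hg, partialTwo_add hf.partialTwo hg.partialTwo,
    partialThree_add hf.partialThree hg.partialThree,
    partialTwo_add hf.partialThree hg.partialThree]
  refine ⟨by linarith, by linarith, ?_⟩
  linarith

/-- The Levi determinant of `φ(u + v)` divided by `φ²`. The only negative term in its expansion is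
`-q(u - v)²`. By `h2`, `p² - q ≥ p²/2`, so the leading term is at least `p³uv(u + v)/2`, which by
`h3` is at least `q(u + v)²`. -/
lemma levi_det_ineq {u v p q : ℝ} (hu : 0 < u) (hv : 0 < v) (hp : 0 ≤ p) (hq : 0 ≤ q)
    (h2 : 2 * q ≤ p ^ 2) (h3 : 2 * q * (u + v) ≤ p ^ 3 * (u * v)) :
    ((p ^ 2 - q) * (u * v) + 1) ^ 2 + (p * u - p * v) ^ 2 ≤
      (1 + ((p ^ 2 - q) * u ^ 2 + p * u)) * (1 + ((p ^ 2 - q) * v ^ 2 + p * v)) := by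
  have e : (1 + ((p ^ 2 - q) * u ^ 2 + p * u)) * (1 + ((p ^ 2 - q) * v ^ 2 + p * v))
      - (((p ^ 2 - q) * (u * v) + 1) ^ 2 + (p * u - p * v) ^ 2)
      = p * (p ^ 2 - q) * (u * v) * (u + v) - q * (u - v) ^ 2 + p ^ 2 * (u * v) + p * (u + v) := by
    ring
  have a1 : p ^ 3 * (u * v) * (u + v) ≤ 2 * (p * (p ^ 2 - q) * (u * v) * (u + v)) := by
    have : 0 ≤ p * (u * v) * (u + v) * (p ^ 2 - 2 * q) :=
      mul_nonneg (by positivity) (by linarith)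
    nlinarith
  have a2 : 2 * q * (u + v) * (u + v) ≤ p ^ 3 * (u * v) * (u + v) :=
    mul_le_mul_of_nonneg_right h3 (by positivity)
  have a3 : q * (u - v) ^ 2 ≤ q * (u + v) * (u + v) := by
    have : 0 ≤ q * (u * v) := by positivity
    nlinarith
  have a4 : 0 ≤ p ^ 2 * (u * v) + p * (u + v) := by positivity
  linarith

lemma leviNonneg_radialProfile {A B c s m K : ℝ} (hc : 0 < c) (hs : s ^ 2 = 1)
    (hm : 0 < m) (hK : 0 < K) (hc1 : 4 * K ≤ c) (hc2 : K ^ 3 ≤ c * m ^ 2) {t : ℝ × ℝ}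
    (hu : m ≤ Real.exp (s * t.1)) (hv : m ≤ Real.exp (s * t.2)) (hS : expSum s t ≤ K) :
    LeviNonneg (fun t => radialProfile A B c (expSum s t)) t := by
  have hφ := contDiff_radialProfile A B c
  unfold LeviNonneg
  rw [partialTwo_partialTwo_comp_expSum hφ, partialThree_partialThree_comp_expSum hφ,
    partialTwo_partialThree_comp_expSum hφ, partialTwo_comp_expSum hφ, partialThree_comp_expSum hφ]
  beta_reduce
  rcases le_or_gt (expSum s t) (B ^ 2) with h | h
  · rw [deriv_radialProfile_of_le hc h, deriv_deriv_radialProfile_of_le hc h,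
      radialProfile_of_le hc h]
    simp
  rw [deriv_radialProfile_of_lt hc h, deriv_deriv_radialProfile_of_lt hc h]
  have hE := radialProfile_nonneg A B c (expSum s t)
  set E := radialProfile A B c (expSum s t)
  set D := expSum s t - B ^ 2 with hD
  have hD0 : 0 < D := by linarith
  have hDK : D ≤ K := by nlinarith [sq_nonneg B]
  have hSuv : expSum s t = Real.exp (s * t.1) + Real.exp (s * t.2) := rfl
  set u := Real.exp (s * t.1)
  set v := Real.exp (s * t.2)
  have hu0 : 0 < u := hm.trans_le hu
  have hv0 : 0 < v := hm.trans_le hv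
  set p := c / D ^ 2 with hp
  set q := 2 * c / D ^ 3 with hq
  have hp0 : 0 ≤ p := by positivity
  have hq0 : 0 ≤ q := by positivity
  -- After clearing denominators this is `4D ≤ c`.
  have h2 : 2 * q ≤ p ^ 2 := by
    rw [hp, hq, div_pow, ← mul_div_assoc, div_le_div_iff₀ (by positivity) (by positivity)]
    have : 0 ≤ (c - 4 * D) * (c * D ^ 3) := mul_nonneg (by linarith) (by positivity)
    nlinarith
  -- After clearing denominators this is `4D³(u + v) ≤ c²uv`; it follows from `D, u + v ≤ K`, `uv ≥
  -- m²` and the product of the two lower bounds on `c`.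
  have h3 : 2 * q * (u + v) ≤ p ^ 3 * (u * v) := by
    rw [hp, hq, div_pow, ← mul_div_assoc, div_mul_eq_mul_div, div_mul_eq_mul_div,
      div_le_div_iff₀ (by positivity) (by positivity)]
    have hm2 : m ^ 2 ≤ u * v := by nlinarith
    have hcK : 4 * K ^ 4 ≤ c ^ 2 * (u * v) := by
      calc 4 * K ^ 4 = 4 * K * K ^ 3 := by ring
        _ ≤ c * (c * m ^ 2) := mul_le_mul hc1 hc2 (by positivity) hc.le
        _ ≤ c * (c * (u * v)) := by gcongr
        _ = c ^ 2 * (u * v) := by ring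
    have hDS : D ^ 3 * (u + v) ≤ K ^ 4 := by
      calc D ^ 3 * (u + v) ≤ K ^ 3 * K := by
            apply mul_le_mul (by gcongr) (hSuv ▸ hS) (by positivity) (by positivity)
        _ = K ^ 4 := by ring
    have : 0 ≤ (c ^ 2 * (u * v) - 4 * (D ^ 3 * (u + v))) * (c * D ^ 3) :=
      mul_nonneg (by linarith) (by positivity)
    nlinarith
  have key := levi_det_ineq hu0 hv0 hp0 hq0 h2 h3
  have hpq : 0 ≤ p ^ 2 - q := by nlinarith
  refine ⟨?_, ?_, ?_⟩
  · rw [mul_pow, hs]; positivity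
  · rw [mul_pow, hs]; positivity
  · have e1 : E * (p ^ 2 - q) * (s * u) * (s * v) = E * ((p ^ 2 - q) * (u * v)) := by
      linear_combination E * (p ^ 2 - q) * u * v * hs
    have e2 : (E * p * (s * u) - E * p * (s * v)) ^ 2 = E ^ 2 * (p * u - p * v) ^ 2 := by
      linear_combination E ^ 2 * p ^ 2 * (u - v) ^ 2 * hs
    rw [e1, e2, mul_pow, mul_pow, hs]
    have := mul_le_mul_of_nonneg_left key (sq_nonneg E)
    linarith

/-! ### Geometry of the domain -/

/-- The pair `(log |z₂|², log |z₃|²)`. -/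
def logPair (z : ℂ × ℂ × ℂ) : ℝ × ℝ := (Real.log (‖z.2.1‖ ^ 2), Real.log (‖z.2.2‖ ^ 2))

/-- The centre `e^{i log |z₂ z₃|²}` of the fibre of the domain over `(z₂, z₃)`. -/
def wormCenter (z : ℂ × ℂ × ℂ) : ℂ :=
  Complex.exp (Complex.I * (Real.log (‖z.2.1 * z.2.2‖ ^ 2) : ℂ))

/-- The defining function `|z₁ - e^{i log |z₂ z₃|²}|² - 1 + η` of `wormDomain η`. -/
def wormFn (η : ℝ × ℝ → ℝ) (z : ℂ × ℂ × ℂ) : ℝ :=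
  ‖z.1 - wormCenter z‖ ^ 2 - 1 + η (logPair z)

lemma mem_wormDomain {η : ℝ × ℝ → ℝ} {z : ℂ × ℂ × ℂ} :
    z ∈ wormDomain η ↔ z.2.1 ≠ 0 ∧ z.2.2 ≠ 0 ∧ wormFn η z < 0 := by
  refine and_congr_right fun _ => and_congr_right fun _ => ?_
  unfold wormFn wormCenter logPair
  constructor <;> intro h <;> linarith

lemma norm_wormCenter (z : ℂ × ℂ × ℂ) : ‖wormCenter z‖ = 1 := by
  rw [wormCenter, mul_comm]
  exact Complex.norm_exp_ofReal_mul_I _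

lemma isOpen_ne_zero : IsOpen {z : ℂ × ℂ × ℂ | z.2.1 ≠ 0 ∧ z.2.2 ≠ 0} :=
  (isOpen_ne_fun (by fun_prop) (by fun_prop)).inter (isOpen_ne_fun (by fun_prop) (by fun_prop))

lemma contDiffAt_logPair {z : ℂ × ℂ × ℂ} (h2 : z.2.1 ≠ 0) (h3 : z.2.2 ≠ 0) :
    ContDiffAt ℝ ∞ logPair z := by
  have a : ContDiffAt ℝ ∞ (fun z : ℂ × ℂ × ℂ => ‖z.2.1‖ ^ 2) z :=
    (ContDiff.norm_sq ℝ (by fun_prop)).contDiffAt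
  have b : ContDiffAt ℝ ∞ (fun z : ℂ × ℂ × ℂ => ‖z.2.2‖ ^ 2) z :=
    (ContDiff.norm_sq ℝ (by fun_prop)).contDiffAt
  exact (a.log (by positivity)).prodMk (b.log (by positivity))

lemma contDiffAt_wormCenter {z : ℂ × ℂ × ℂ} (h2 : z.2.1 ≠ 0) (h3 : z.2.2 ≠ 0) :
    ContDiffAt ℝ ∞ wormCenter z := by
  have a : ContDiffAt ℝ ∞ (fun z : ℂ × ℂ × ℂ => ‖z.2.1 * z.2.2‖ ^ 2) z :=
    (ContDiff.norm_sq ℝ (by fun_prop)).contDiffAt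
  have hne := mul_ne_zero h2 h3
  have b := a.log (by positivity)
  exact (contDiffAt_const.mul (Complex.ofRealCLM.contDiff.contDiffAt.comp z b)).cexp

lemma contDiffAt_wormFn {η : ℝ × ℝ → ℝ} (hη : ContDiff ℝ ∞ η) {z : ℂ × ℂ × ℂ}
    (h2 : z.2.1 ≠ 0) (h3 : z.2.2 ≠ 0) : ContDiffAt ℝ ∞ (wormFn η) z :=
  (((contDiffAt_fst.sub (contDiffAt_wormCenter h2 h3)).norm_sq ℝ).sub contDiffAt_const).add
    (hη.contDiffAt.comp z (contDiffAt_logPair h2 h3))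

lemma isOpen_wormDomain {η : ℝ × ℝ → ℝ} (hη : ContDiff ℝ ∞ η) : IsOpen (wormDomain η) := by
  have hc : ContinuousOn (wormFn η) {z : ℂ × ℂ × ℂ | z.2.1 ≠ 0 ∧ z.2.2 ≠ 0} := fun z hz =>
    (contDiffAt_wormFn hη hz.1 hz.2).continuousAt.continuousWithinAt
  have := hc.isOpen_inter_preimage isOpen_ne_zero (isOpen_Iio (a := 0))
  convert this using 1
  ext z
  rw [mem_wormDomain, ← and_assoc]
  rfl

/-- The closed region in which the closure of a bounded `wormDomain` is contained. -/
def logBox (M : ℝ) : Set (ℂ × ℂ × ℂ) :=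
  {z | ‖z.2.1‖ ^ 2 ∈ Set.Icc (Real.exp (-M)) (Real.exp M) ∧
    ‖z.2.2‖ ^ 2 ∈ Set.Icc (Real.exp (-M)) (Real.exp M)}

lemma isClosed_logBox (M : ℝ) : IsClosed (logBox M) :=
  (isClosed_Icc.preimage (by fun_prop : Continuous fun z : ℂ × ℂ × ℂ => ‖z.2.1‖ ^ 2)).inter
    (isClosed_Icc.preimage (by fun_prop : Continuous fun z : ℂ × ℂ × ℂ => ‖z.2.2‖ ^ 2))

lemma ne_zero_of_mem_logBox {M : ℝ} {z : ℂ × ℂ × ℂ} (hz : z ∈ logBox M) :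
    z.2.1 ≠ 0 ∧ z.2.2 ≠ 0 := by
  obtain ⟨⟨h2, -⟩, h3, -⟩ := hz
  constructor
  · intro h
    rw [h] at h2
    norm_num at h2
    exact absurd h2 (not_le.2 (Real.exp_pos _))
  · intro h
    rw [h] at h3
    norm_num at h3
    exact absurd h3 (not_le.2 (Real.exp_pos _))

lemma lt_one_of_mem_wormDomain {η : ℝ × ℝ → ℝ} {z : ℂ × ℂ × ℂ} (hz : z ∈ wormDomain η) :
    η (logPair z) < 1 := by
  have := (mem_wormDomain.1 hz).2.2
  unfold wormFn at this
  nlinarith [sq_nonneg ‖z.1 - wormCenter z‖]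

lemma mem_Icc_exp_of_abs_log_le {x M : ℝ} (hx : 0 < x) (h : |Real.log x| ≤ M) :
    x ∈ Set.Icc (Real.exp (-M)) (Real.exp M) := by
  rw [abs_le] at h
  exact ⟨(Real.le_log_iff_exp_le hx).1 h.1, (Real.log_le_iff_le_exp hx).1 h.2⟩

lemma wormDomain_subset_logBox {η : ℝ × ℝ → ℝ} {M : ℝ}
    (hM : ∀ t, η t < 1 → |t.1| ≤ M ∧ |t.2| ≤ M) : wormDomain η ⊆ logBox M := by
  intro z hz
  have h := hM _ (lt_one_of_mem_wormDomain hz)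
  obtain ⟨h2, h3, -⟩ := mem_wormDomain.1 hz
  exact ⟨mem_Icc_exp_of_abs_log_le (by positivity) h.1,
    mem_Icc_exp_of_abs_log_le (by positivity) h.2⟩

lemma isClosed_logBox_inter {η : ℝ × ℝ → ℝ} (hη : ContDiff ℝ ∞ η) (M a : ℝ) :
    IsClosed {z ∈ logBox M | wormFn η z ≤ a} := by
  have hc : ContinuousOn (wormFn η) (logBox M) := fun z hz =>
    (contDiffAt_wormFn hη (ne_zero_of_mem_logBox hz).1
      (ne_zero_of_mem_logBox hz).2).continuousAt.continuousWithinAt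
  exact hc.preimage_isClosed_of_isClosed (isClosed_logBox M) isClosed_Iic

/-- The box is closed in `ℂ³` and misses the axes `z₂z₃ = 0`, so every boundary point lies where the
defining function is smooth. -/
lemma closure_wormDomain_subset {η : ℝ × ℝ → ℝ} (hη : ContDiff ℝ ∞ η) {M : ℝ}
    (hM : ∀ t, η t < 1 → |t.1| ≤ M ∧ |t.2| ≤ M) :
    closure (wormDomain η) ⊆ {z ∈ logBox M | wormFn η z ≤ 0} :=
  closure_minimal (fun _ hz => ⟨wormDomain_subset_logBox hM hz, (mem_wormDomain.1 hz).2.2.le⟩)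
    (isClosed_logBox_inter hη M 0)

lemma isBounded_logBox_inter {η : ℝ × ℝ → ℝ} (h0 : ∀ t, 0 ≤ η t) (M : ℝ) :
    Bornology.IsBounded {z ∈ logBox M | wormFn η z ≤ 0} := by
  have hs : ∀ x : ℝ, 0 ≤ x → x ^ 2 ≤ Real.exp M → x ≤ 1 + Real.exp M := fun x hx h => by
    nlinarith [sq_nonneg (x - 1), Real.exp_pos M]
  refine (Metric.isBounded_closedBall (x := (0 : ℂ × ℂ × ℂ)) (r := 2 + Real.exp M)).subset ?_
  rintro z ⟨⟨⟨-, h2⟩, -, h3⟩, hr⟩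
  have h1 : ‖z.1 - wormCenter z‖ ≤ 1 := by
    have := h0 (logPair z)
    unfold wormFn at hr
    nlinarith [norm_nonneg (z.1 - wormCenter z)]
  have h1' : ‖z.1‖ ≤ 2 := by
    calc ‖z.1‖ = ‖(z.1 - wormCenter z) + wormCenter z‖ := by rw [sub_add_cancel]
      _ ≤ 1 + 1 := (norm_add_le _ _).trans (add_le_add h1 (norm_wormCenter z).le)
      _ = 2 := by norm_num
  rw [mem_closedBall_zero_iff, Prod.norm_def, Prod.norm_def]
  have := Real.exp_pos M
  refine max_le (by linarith) (max_le ?_ ?_)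
  · linarith [hs _ (norm_nonneg _) h2]
  · linarith [hs _ (norm_nonneg _) h3]

lemma isBounded_wormDomain {η : ℝ × ℝ → ℝ} (h0 : ∀ t, 0 ≤ η t) {M : ℝ}
    (hM : ∀ t, η t < 1 → |t.1| ≤ M ∧ |t.2| ≤ M) : Bornology.IsBounded (wormDomain η) :=
  (isBounded_logBox_inter h0 M).subset
    (fun _ hz => ⟨wormDomain_subset_logBox hM hz, (mem_wormDomain.1 hz).2.2.le⟩)

lemma mem_logBox_of_mem_frontier {η : ℝ × ℝ → ℝ} (hη : ContDiff ℝ ∞ η) {M : ℝ}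
    (hM : ∀ t, η t < 1 → |t.1| ≤ M ∧ |t.2| ≤ M) {z : ℂ × ℂ × ℂ}
    (hz : z ∈ frontier (wormDomain η)) : z ∈ logBox M ∧ wormFn η z = 0 := by
  rw [(isOpen_wormDomain hη).frontier_eq] at hz
  obtain ⟨hb, hr⟩ := closure_wormDomain_subset hη hM hz.1
  refine ⟨hb, hr.antisymm (not_lt.1 fun h => hz.2 ?_)⟩
  exact mem_wormDomain.2 ⟨(ne_zero_of_mem_logBox hb).1, (ne_zero_of_mem_logBox hb).2, h⟩

lemma logPair_exp {z : ℂ} {x y : ℂ} : logPair (z, Complex.exp x, Complex.exp y) =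
    (2 * x.re, 2 * y.re) := by
  simp only [logPair, Complex.norm_exp, ← Real.exp_nat_mul, Real.log_exp]
  norm_num

lemma wormCenter_exp {z : ℂ} {x y : ℂ} : wormCenter (z, Complex.exp x, Complex.exp y) =
    Complex.exp (Complex.I * ((2 * (x.re + y.re) : ℝ) : ℂ)) := by
  simp only [wormCenter, ← Complex.exp_add, Complex.norm_exp, ← Real.exp_nat_mul, Real.log_exp]
  norm_num

lemma exists_exp_eq {z : ℂ × ℂ × ℂ} (h2 : z.2.1 ≠ 0) (h3 : z.2.2 ≠ 0) :
    ∃ x y : ℂ, z = (z.1, Complex.exp x, Complex.exp y) :=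
  ⟨Complex.log z.2.1, Complex.log z.2.2, by rw [Complex.exp_log h2, Complex.exp_log h3]⟩

/-- Off the centre of the fibre, the radial direction in `z₁` has derivative `2|z₁ - C|² > 0`, where
`C` is that centre. At the centre `η = 1`, the squared norm vanishes to second order, and the
derivative along curves in `(z₂, z₃)` reduces to that of `η`, which is nonzero by regularity. -/
lemma fderiv_wormFn_ne_zero {η : ℝ × ℝ → ℝ} (hη : ContDiff ℝ ∞ η) (hreg : WormRegular η)
    {z : ℂ × ℂ × ℂ} (h2 : z.2.1 ≠ 0) (h3 : z.2.2 ≠ 0) (hz : wormFn η z = 0) :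
    fderiv ℝ (wormFn η) z ≠ 0 := by
  intro h0
  have hd : HasFDerivAt (wormFn η) (0 : ℂ × ℂ × ℂ →L[ℝ] ℝ) z :=
    h0 ▸ ((contDiffAt_wormFn hη h2 h3).differentiableAt (by simp)).hasFDerivAt
  by_cases hw : z.1 = wormCenter z
  · have h1 : η (logPair z) = 1 := by
      simp only [wormFn, hw, sub_self, norm_zero] at hz
      norm_num at hz
      linarith
    refine hreg _ h1 (ContinuousLinearMap.ext fun v => ?_)
    obtain ⟨x, y, hxy⟩ := exists_exp_eq h2 h3
    -- The speed is `v/2` because `logPair` doubles the real parts of the logarithms.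
    have hx : HasDerivAt (fun s : ℝ => Complex.exp (x + ((s * (v.1 / 2) : ℝ) : ℂ)))
        (Complex.exp (x + (((0 : ℝ) * (v.1 / 2) : ℝ) : ℂ)) * ((v.1 / 2 : ℝ) : ℂ)) 0 := by
      refine (HasDerivAt.const_add x ?_).cexp
      simpa using ((hasDerivAt_id (0 : ℝ)).mul_const (v.1 / 2)).ofReal_comp
    have hy : HasDerivAt (fun s : ℝ => Complex.exp (y + ((s * (v.2 / 2) : ℝ) : ℂ)))
        (Complex.exp (y + (((0 : ℝ) * (v.2 / 2) : ℝ) : ℂ)) * ((v.2 / 2 : ℝ) : ℂ)) 0 := by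
      refine (HasDerivAt.const_add y ?_).cexp
      simpa using ((hasDerivAt_id (0 : ℝ)).mul_const (v.2 / 2)).ofReal_comp
    have hγ := (hasDerivAt_const (0 : ℝ) z.1).prodMk (hx.prodMk hy)
    have hγ0 : z = (z.1, Complex.exp (x + (((0 : ℝ) * (v.1 / 2) : ℝ) : ℂ)),
        Complex.exp (y + (((0 : ℝ) * (v.2 / 2) : ℝ) : ℂ))) := by
      simpa using hxy
    have hcomp := HasFDerivAt.comp_hasDerivAt (0 : ℝ) (hγ0 ▸ hd) hγ
    have hexp : HasDerivAt (fun s : ℝ => z.1 - Complex.exp (Complex.I *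
        ((2 * ((x.re + s * (v.1 / 2)) + (y.re + s * (v.2 / 2))) : ℝ) : ℂ)))
        (-(Complex.exp (Complex.I *
        ((2 * ((x.re + 0 * (v.1 / 2)) + (y.re + 0 * (v.2 / 2))) : ℝ) : ℂ)) *
          (Complex.I * ((2 * (v.1 / 2 + v.2 / 2) : ℝ) : ℂ)))) 0 := by
      refine HasDerivAt.const_sub _ (HasDerivAt.cexp (HasDerivAt.const_mul _
        (HasDerivAt.ofReal_comp ?_)))
      have a1 := ((hasDerivAt_id (0 : ℝ)).mul_const (v.1 / 2)).const_add x.re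
      have a2 := ((hasDerivAt_id (0 : ℝ)).mul_const (v.2 / 2)).const_add y.re
      simpa using (a1.add a2).const_mul 2
    have hη' : HasDerivAt (fun s : ℝ => η (2 * (x.re + s * (v.1 / 2)), 2 * (y.re + s * (v.2 / 2))))
        (partialTwo η (logPair z) * v.1 + partialThree η (logPair z) * v.2) 0 := by
      have e : logPair z = (2 * (x.re + 0 * (v.1 / 2)), 2 * (y.re + 0 * (v.2 / 2))) := by
        rw [hxy, logPair_exp]; simp
      rw [e]
      refine hasDerivAt_comp_prod (x := fun s => 2 * (x.re + s * (v.1 / 2)))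
        (y := fun s => 2 * (y.re + s * (v.2 / 2))) (hη.differentiable (by simp) _) ?_ ?_
      · have := (((hasDerivAt_id (0 : ℝ)).mul_const (v.1 / 2)).const_add x.re).const_mul 2
        refine this.congr_deriv (by ring)
      · have := (((hasDerivAt_id (0 : ℝ)).mul_const (v.2 / 2)).const_add y.re).const_mul 2
        refine this.congr_deriv (by ring)
    have htot := (hexp.norm_sq.sub_const 1).add hη'
    have hzero : z.1 - Complex.exp (Complex.I *
        ((2 * ((x.re + 0 * (v.1 / 2)) + (y.re + 0 * (v.2 / 2))) : ℝ) : ℂ)) = 0 := by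
      rw [hxy, wormCenter_exp] at hw
      simpa [sub_eq_zero] using hw
    have heq := hcomp.unique (htot.congr_of_eventuallyEq (Filter.Eventually.of_forall fun s => by
      simp only [Function.comp, wormFn, wormCenter_exp, logPair_exp, Complex.add_re,
        Complex.ofReal_re, Pi.add_apply]))
    rw [hzero] at heq
    rw [fderiv_apply_eq_partial]
    simpa using heq.symm
  · have hγ : HasDerivAt (fun s : ℝ => (z.1 + (s : ℂ) * (z.1 - wormCenter z), z.2))
        ((z.1 - wormCenter z), (0 : ℂ × ℂ)) 0 := by
      refine HasDerivAt.prodMk (HasDerivAt.const_add _ ?_) (hasDerivAt_const _ _)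
      simpa using ((hasDerivAt_id (0 : ℝ)).ofReal_comp).mul_const (z.1 - wormCenter z)
    have hγ0 : z = (z.1 + ((0 : ℝ) : ℂ) * (z.1 - wormCenter z), z.2) := by simp
    have hcomp := HasFDerivAt.comp_hasDerivAt (0 : ℝ) (hγ0 ▸ hd) hγ
    have hdir : HasDerivAt (fun s : ℝ => (1 + s) ^ 2 * ‖z.1 - wormCenter z‖ ^ 2 - 1
        + η (logPair z)) (2 * ‖z.1 - wormCenter z‖ ^ 2) 0 := by
      have := ((((hasDerivAt_id (0 : ℝ)).const_add 1).pow 2).mul_const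
        (‖z.1 - wormCenter z‖ ^ 2)).sub_const 1 |>.add_const (η (logPair z))
      refine this.congr_deriv (by simp)
    have heq := hcomp.unique (hdir.congr_of_eventuallyEq (Filter.Eventually.of_forall fun s => by
      have e : z.1 + (s : ℂ) * (z.1 - wormCenter z) - wormCenter z
          = ((1 + s : ℝ) : ℂ) * (z.1 - wormCenter z) := by push_cast; ring
      change ‖z.1 + (s : ℂ) * (z.1 - wormCenter z) - wormCenter z‖ ^ 2 - 1 + η (logPair z) = _
      rw [e, norm_mul, mul_pow, Complex.norm_real, Real.norm_eq_abs, sq_abs]))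
    have : ‖z.1 - wormCenter z‖ ≠ 0 := norm_ne_zero_iff.2 (sub_ne_zero.2 hw)
    simp only [zero_apply] at heq
    have h4 : ‖z.1 - wormCenter z‖ ^ 2 = 0 := by linarith
    exact this (pow_eq_zero_iff (by norm_num) |>.1 h4)

lemma hasSmoothBoundary_wormDomain {η : ℝ × ℝ → ℝ} (hη : ContDiff ℝ ∞ η) (hreg : WormRegular η)
    {M : ℝ} (hM : ∀ t, η t < 1 → |t.1| ≤ M ∧ |t.2| ≤ M) : HasSmoothBoundary (wormDomain η) := by
  intro p hp
  obtain ⟨hb, hr⟩ := mem_logBox_of_mem_frontier hη hM hp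
  obtain ⟨h2, h3⟩ := ne_zero_of_mem_logBox hb
  refine ⟨_, wormFn η, isOpen_ne_zero, ⟨h2, h3⟩, fun z hz =>
    (contDiffAt_wormFn hη hz.1 hz.2).contDiffWithinAt, fderiv_wormFn_ne_zero hη hreg h2 h3 hr, ?_⟩
  ext z
  simp only [Set.mem_inter_iff, mem_wormDomain, Set.mem_ofPred_eq]
  tauto

/-- The domain is the continuous image of (unit disk) × `{η < 1}` × (arguments in `ℝ²`): each fibre
is a disk of radius `√(1 - η)` about the centre. -/
lemma isConnected_wormDomain {η : ℝ × ℝ → ℝ} (hη : Continuous η)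
    (hconn : IsConnected {t | η t < 1}) : IsConnected (wormDomain η) := by
  set f : ℂ × (ℝ × ℝ) × (ℝ × ℝ) → ℂ × ℂ × ℂ := fun p =>
    (Complex.exp (Complex.I * ((p.2.1.1 + p.2.1.2 : ℝ) : ℂ))
      + ((Real.sqrt (1 - η p.2.1) : ℝ) : ℂ) * p.1,
      Complex.exp (((p.2.1.1 / 2 : ℝ) : ℂ) + ((p.2.2.1 : ℝ) : ℂ) * Complex.I),
      Complex.exp (((p.2.1.2 / 2 : ℝ) : ℂ) + ((p.2.2.2 : ℝ) : ℂ) * Complex.I)) with hf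
  have hfc : Continuous f := by rw [hf]; fun_prop
  have hS : IsConnected (Metric.ball (0 : ℂ) 1 ×ˢ ({t | η t < 1} ×ˢ (Set.univ : Set (ℝ × ℝ)))) :=
    ((convex_ball (0 : ℂ) 1).isPathConnected ⟨0, by simp⟩).isConnected.prod
      (hconn.prod isConnected_univ)
  have him := hS.image f hfc.continuousOn
  convert him using 1
  ext z
  constructor
  · intro hz
    have hlt := lt_one_of_mem_wormDomain hz
    obtain ⟨h2, h3, hr⟩ := mem_wormDomain.1 hz
    obtain ⟨x, y, hxy⟩ := exists_exp_eq h2 h3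
    have hL : logPair z = (2 * x.re, 2 * y.re) := by rw [hxy, logPair_exp]
    have hC : wormCenter z = Complex.exp (Complex.I * ((2 * (x.re + y.re) : ℝ) : ℂ)) := by
      rw [hxy, wormCenter_exp]
    rw [hL] at hlt
    have hs : 0 < Real.sqrt (1 - η (2 * x.re, 2 * y.re)) := Real.sqrt_pos.2 (by linarith)
    have hsq := Real.sq_sqrt (by linarith : 0 ≤ 1 - η (2 * x.re, 2 * y.re))
    set σ := Real.sqrt (1 - η (2 * x.re, 2 * y.re)) with hσ
    refine ⟨((z.1 - wormCenter z) / (σ : ℂ), (2 * x.re, 2 * y.re), (x.im, y.im)),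
      ⟨?_, hlt, trivial⟩, ?_⟩
    · rw [mem_ball_zero_iff, norm_div, Complex.norm_real, Real.norm_of_nonneg hs.le,
        div_lt_one hs]
      refine lt_of_pow_lt_pow_left₀ 2 hs.le ?_
      unfold wormFn at hr
      rw [hL] at hr
      linarith
    · have hσ0 : (σ : ℂ) ≠ 0 := by exact_mod_cast hs.ne'
      have hx : (((2 * x.re / 2 : ℝ) : ℂ) + ((x.im : ℝ) : ℂ) * Complex.I) = x := by
        rw [mul_div_cancel_left₀ _ (two_ne_zero' ℝ)]; exact Complex.re_add_im x
      have hy : (((2 * y.re / 2 : ℝ) : ℂ) + ((y.im : ℝ) : ℂ) * Complex.I) = y := by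
        rw [mul_div_cancel_left₀ _ (two_ne_zero' ℝ)]; exact Complex.re_add_im y
      simp only [hf]
      rw [hx, hy, ← hσ, mul_div_cancel₀ _ hσ0, hC, ← mul_add]
      conv_rhs => rw [hxy]
      simp
  · rintro ⟨⟨w, t, θ⟩, ⟨hw, ht, -⟩, rfl⟩
    have ht' : η t < 1 := ht
    refine mem_wormDomain.2 ⟨Complex.exp_ne_zero _, Complex.exp_ne_zero _, ?_⟩
    have hs : 0 < Real.sqrt (1 - η t) := Real.sqrt_pos.2 (by linarith)
    have hsq := Real.sq_sqrt (by linarith : 0 ≤ 1 - η t)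
    have e1 : logPair (f (w, t, θ)) = t := by
      simp only [hf, logPair_exp]; ext <;> simp <;> ring
    have e2 : (f (w, t, θ)).1 - wormCenter (f (w, t, θ)) = ((Real.sqrt (1 - η t) : ℝ) : ℂ) * w := by
      simp only [hf, wormCenter_exp]
      have : (2 * ((((t.1 / 2 : ℝ) : ℂ) + ((θ.1 : ℝ) : ℂ) * Complex.I).re
          + (((t.2 / 2 : ℝ) : ℂ) + ((θ.2 : ℝ) : ℂ) * Complex.I).re)) = t.1 + t.2 := by
        simp; ring
      rw [this]; ring
    rw [wormFn, e1, e2, norm_mul, mul_pow, Complex.norm_real, Real.norm_of_nonneg hs.le, hsq]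
    have hw' : ‖w‖ < 1 := by simpa using hw
    have : ‖w‖ ^ 2 < 1 := by nlinarith [norm_nonneg w]
    nlinarith

/-! ### The explicit profile -/

/-- Convexity of `exp` bounds the sum at `a • t` by the convex combination of its values 2 at the
origin and `expSum s t` at `t`. -/
lemma expSum_smul_le (s : ℝ) (t : ℝ × ℝ) {a : ℝ} (h0 : 0 ≤ a) (h1 : a ≤ 1) :
    expSum s (a • t) ≤ max 2 (expSum s t) := by
  have key : ∀ x : ℝ, Real.exp (s * (a * x)) ≤ (1 - a) + a * Real.exp (s * x) := fun x => by
    have := convexOn_exp.2 (Set.mem_univ 0) (Set.mem_univ (s * x)) (sub_nonneg.2 h1) h0 (by ring)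
    simp only [smul_eq_mul, mul_zero, zero_add, Real.exp_zero, mul_one] at this
    rwa [mul_left_comm]
  have h2 := key t.1
  have h3 := key t.2
  have hle : expSum s (a • t) ≤ (1 - a) * 2 + a * expSum s t := by
    simp only [expSum, Prod.smul_fst, Prod.smul_snd, smul_eq_mul]
    linarith
  have ha : (1 - a) * 2 ≤ (1 - a) * max 2 (expSum s t) :=
    mul_le_mul_of_nonneg_left (le_max_left _ _) (by linarith)
  have hb : a * expSum s t ≤ a * max 2 (expSum s t) :=
    mul_le_mul_of_nonneg_left (le_max_right _ _) h0
  linarith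

lemma radialProfile_expSum_smul_le {A B c : ℝ} (hc : 0 < c) (hB : 2 ≤ B ^ 2) (s : ℝ) (t : ℝ × ℝ)
    {a : ℝ} (h0 : 0 ≤ a) (h1 : a ≤ 1) :
    radialProfile A B c (expSum s (a • t)) ≤ radialProfile A B c (expSum s t) := by
  refine (monotone_radialProfile A B hc (expSum_smul_le s t h0 h1)).trans ?_
  rcases le_total (expSum s t) 2 with h | h
  · rw [max_eq_left h, radialProfile_of_le hc hB]
    exact radialProfile_nonneg _ _ _ _
  · rw [max_eq_right h]

/-- From `e^{-y} ≥ 1 - y` comes `y e^y ≥ e^y - 1`. Summed over `y = s t₂` and `y = s t₃`, the right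
side is the exponential sum minus 2. -/
lemma radial_derivative_pos {s : ℝ} {t : ℝ × ℝ} (h : 2 < expSum s t) :
    0 < s * Real.exp (s * t.1) * t.1 + s * Real.exp (s * t.2) * t.2 := by
  have key : ∀ x : ℝ, Real.exp (s * x) - 1 ≤ s * Real.exp (s * x) * x := fun x => by
    have h1 := Real.add_one_le_exp (-(s * x))
    have h2 := Real.exp_pos (s * x)
    have h3 : Real.exp (s * x) * Real.exp (-(s * x)) = 1 := by rw [← Real.exp_add]; simp
    nlinarith
  have h1 := key t.1
  have h2 := key t.2
  unfold expSum at h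
  linarith

lemma fderiv_radialProfile_radial {A B c : ℝ} (s : ℝ) (t : ℝ × ℝ) :
    fderiv ℝ (fun t => radialProfile A B c (expSum s t)) t t =
      deriv (radialProfile A B c) (expSum s t) *
        (s * Real.exp (s * t.1) * t.1 + s * Real.exp (s * t.2) * t.2) := by
  have hφ := contDiff_radialProfile A B c
  rw [fderiv_apply_eq_partial, partialTwo_comp_expSum hφ, partialThree_comp_expSum hφ]
  ring

lemma fderiv_radialProfile_radial_nonneg {A B c : ℝ} (hc : 0 < c) (hB : 2 ≤ B ^ 2) (s : ℝ)
    (t : ℝ × ℝ) : 0 ≤ fderiv ℝ (fun t => radialProfile A B c (expSum s t)) t t := by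
  rw [fderiv_radialProfile_radial]
  rcases le_or_gt (expSum s t) (B ^ 2) with h | h
  · rw [deriv_radialProfile_of_le hc h, zero_mul]
  · exact mul_nonneg (deriv_radialProfile_nonneg _ _ hc _)
      (radial_derivative_pos (hB.trans_lt h)).le

lemma fderiv_radialProfile_radial_pos {A B c : ℝ} (hc : 0 < c) (hB : 2 ≤ B ^ 2) {s : ℝ}
    {t : ℝ × ℝ} (h : radialProfile A B c (expSum s t) ≠ 0) :
    0 < fderiv ℝ (fun t => radialProfile A B c (expSum s t)) t t := by
  rw [fderiv_radialProfile_radial]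
  have hlt : B ^ 2 < expSum s t := not_le.1 fun h' => h (radialProfile_of_le hc h')
  exact mul_pos (deriv_radialProfile_pos hc hlt) (radial_derivative_pos (hB.trans_lt hlt))

lemma expSum_le_of_abs_lt {s μ : ℝ} (hs : |s| = 1) {t : ℝ × ℝ} (h1 : |t.1| < μ) (h2 : |t.2| < μ) :
    expSum s t ≤ 2 * Real.exp μ := by
  have key : ∀ x : ℝ, |x| < μ → Real.exp (s * x) ≤ Real.exp μ := fun x hx => by
    refine Real.exp_le_exp.2 ((le_abs_self _).trans ?_)
    rw [abs_mul, hs, one_mul]; exact hx.le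
  have := key _ h1
  have := key _ h2
  unfold expSum
  linarith

lemma mul_lt_log_of_expSum_lt {s K : ℝ} {t : ℝ × ℝ} (h : expSum s t < K) :
    s * t.1 < Real.log K ∧ s * t.2 < Real.log K := by
  have h1 := Real.exp_pos (s * t.1)
  have h2 := Real.exp_pos (s * t.2)
  unfold expSum at h
  have hK : 0 < K := by linarith
  exact ⟨(Real.lt_log_iff_exp_lt hK).2 (by linarith), (Real.lt_log_iff_exp_lt hK).2 (by linarith)⟩

section Parameters

/-- Admissibility of a pair of parameters `A > B`, with `B² ≥ 2 e^μ`. -/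
structure WormParams (μ A B : ℝ) : Prop where
  two_exp_le : 2 * Real.exp μ ≤ B ^ 2
  sq_lt : B ^ 2 < A ^ 2
  pos : 0 < A

lemma WormParams.of_sqrt_le {μ A B : ℝ} (h : Real.sqrt (2 * Real.exp μ) ≤ B) (hAB : B < A) :
    WormParams μ A B := by
  have h0 : 0 < Real.sqrt (2 * Real.exp μ) := Real.sqrt_pos.2 (by positivity)
  refine ⟨?_, by nlinarith, by linarith⟩
  have := Real.sq_sqrt (by positivity : 0 ≤ 2 * Real.exp μ)
  nlinarith

lemma WormParams.two_le {μ A B : ℝ} (h : WormParams μ A B) (hμ : 0 ≤ μ) : 2 ≤ B ^ 2 := by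
  have := h.two_exp_le
  have := Real.one_le_exp hμ
  linarith

variable {μ Ap Am Bp Bm cp cm : ℝ}

lemma wormEta_eq (hcp : 0 < cp) (hcm : 0 < cm) : wormEta Ap Am Bp Bm cp cm =
    fun t => radialProfile Ap Bp cp (expSum 1 t) + radialProfile Am Bm cm (expSum (-1) t) := by
  funext t
  rw [wormEta, wormEtaSigned_eq hcp, wormEtaSigned_eq hcm]

lemma contDiff_wormEta (hcp : 0 < cp) (hcm : 0 < cm) :
    ContDiff ℝ ∞ (wormEta Ap Am Bp Bm cp cm) := by
  rw [wormEta_eq hcp hcm]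
  exact (contDiff_comp_expSum (contDiff_radialProfile _ _ _) 1).add
    (contDiff_comp_expSum (contDiff_radialProfile _ _ _) (-1))

lemma wormEta_nonneg (hcp : 0 < cp) (hcm : 0 < cm) (t : ℝ × ℝ) :
    0 ≤ wormEta Ap Am Bp Bm cp cm t := by
  rw [wormEta_eq hcp hcm]
  exact add_nonneg (radialProfile_nonneg _ _ _ _) (radialProfile_nonneg _ _ _ _)

lemma wormEta_eq_zero (hp : WormParams μ Ap Bp) (hm : WormParams μ Am Bm) (hcp : 0 < cp)
    (hcm : 0 < cm) {t : ℝ × ℝ} (ht : t ∈ Set.Ioo (-μ) μ ×ˢ Set.Ioo (-μ) μ) :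
    wormEta Ap Am Bp Bm cp cm t = 0 := by
  have h1 := abs_lt.2 ht.1
  have h2 := abs_lt.2 ht.2
  simp only [wormEta_eq hcp hcm]
  rw [radialProfile_of_le hcp ((expSum_le_of_abs_lt (by simp) h1 h2).trans hp.two_exp_le),
    radialProfile_of_le hcm ((expSum_le_of_abs_lt (by simp) h1 h2).trans hm.two_exp_le), add_zero]

lemma expSum_lt_of_wormEta_lt_one (hp : WormParams μ Ap Bp) (hm : WormParams μ Am Bm)
    (hcp : 0 < cp) (hcm : 0 < cm) {t : ℝ × ℝ} (ht : wormEta Ap Am Bp Bm cp cm t < 1) :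
    expSum 1 t < Ap ^ 2 ∧ expSum (-1) t < Am ^ 2 := by
  rw [wormEta_eq hcp hcm] at ht
  have h1 := radialProfile_nonneg Ap Bp cp (expSum 1 t)
  have h2 := radialProfile_nonneg Am Bm cm (expSum (-1) t)
  exact ⟨(radialProfile_lt_one_iff hcp hp.sq_lt).1 (by linarith),
    (radialProfile_lt_one_iff hcm hm.sq_lt).1 (by linarith)⟩

lemma expSum_le_of_wormEta_le_one (hp : WormParams μ Ap Bp) (hm : WormParams μ Am Bm)
    (hcp : 0 < cp) (hcm : 0 < cm) {t : ℝ × ℝ} (ht : wormEta Ap Am Bp Bm cp cm t ≤ 1) :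
    expSum 1 t ≤ Ap ^ 2 ∧ expSum (-1) t ≤ Am ^ 2 := by
  rw [wormEta_eq hcp hcm] at ht
  have h1 := radialProfile_nonneg Ap Bp cp (expSum 1 t)
  have h2 := radialProfile_nonneg Am Bm cm (expSum (-1) t)
  exact ⟨(radialProfile_le_one_iff hcp hp.sq_lt).1 (by linarith),
    (radialProfile_le_one_iff hcm hm.sq_lt).1 (by linarith)⟩

/-- The set is star-shaped about the origin, since neither summand of `η` increases when `t` is
scaled towards 0. -/
lemma isPathConnected_wormEta_lt_one (hμ : 0 < μ) (hp : WormParams μ Ap Bp)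
    (hm : WormParams μ Am Bm) (hcp : 0 < cp) (hcm : 0 < cm) :
    IsPathConnected {t | wormEta Ap Am Bp Bm cp cm t < 1} := by
  have h0 : wormEta Ap Am Bp Bm cp cm 0 = 0 :=
    wormEta_eq_zero hp hm hcp hcm ⟨⟨by simpa, by simpa⟩, by simpa, by simpa⟩
  have hne : (0 : ℝ × ℝ) ∈ {t | wormEta Ap Am Bp Bm cp cm t < 1} := by
    rw [Set.mem_ofPred_eq, h0]; exact one_pos
  refine StarConvex.isPathConnected (a := 0) (starConvex_zero_iff.2 fun t ht a ha0 ha1 => ?_)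
    hne
  refine lt_of_le_of_lt ?_ (show wormEta Ap Am Bp Bm cp cm t < 1 from ht)
  rw [wormEta_eq hcp hcm]
  exact add_le_add (radialProfile_expSum_smul_le hcp (hp.two_le hμ.le) _ _ ha0 ha1)
    (radialProfile_expSum_smul_le hcm (hm.two_le hμ.le) _ _ ha0 ha1)

lemma isWormProfile_wormEta (hμ : 0 < μ) (hp : WormParams μ Ap Bp)
    (hm : WormParams μ Am Bm) (hcp : 0 < cp) (hcm : 0 < cm) :
    IsWormProfile μ (wormEta Ap Am Bp Bm cp cm) where
  nonneg := wormEta_nonneg hcp hcm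
  upperSemicontinuous := (contDiff_wormEta hcp hcm).continuous.upperSemicontinuous
  eq_zero := fun _ ht => wormEta_eq_zero hp hm hcp hcm ht
  isPathConnected := by
    convert isPathConnected_wormEta_lt_one hμ hp hm hcp hcm using 1
    ext t
    exact and_iff_right (wormEta_nonneg hcp hcm t)

/-- The derivative of `η` at `t` is tested on the vector `t` itself. Both summands contribute
nonnegatively, and where `η = 1` at least one of them is nonzero and contributes strictly. -/
lemma wormRegular_wormEta (hμ : 0 < μ) (hp : WormParams μ Ap Bp)
    (hm : WormParams μ Am Bm) (hcp : 0 < cp) (hcm : 0 < cm) :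
    WormRegular (wormEta Ap Am Bp Bm cp cm) := by
  intro t ht h0
  have h : fderiv ℝ (wormEta Ap Am Bp Bm cp cm) t t = 0 := by rw [h0]; rfl
  rw [wormEta_eq hcp hcm] at ht h
  rw [fderiv_fun_add
    ((contDiff_comp_expSum (contDiff_radialProfile _ _ _) _).differentiable (by simp) t)
    ((contDiff_comp_expSum (contDiff_radialProfile _ _ _) _).differentiable (by simp) t)] at h
  have h1 := fderiv_radialProfile_radial_nonneg (A := Ap) hcp (hp.two_le hμ.le) 1 t
  have h2 := fderiv_radialProfile_radial_nonneg (A := Am) hcm (hm.two_le hμ.le) (-1) t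
  have h' : fderiv ℝ (fun t => radialProfile Ap Bp cp (expSum 1 t)) t t
    + fderiv ℝ (fun t => radialProfile Am Bm cm (expSum (-1) t)) t t = 0 := h
  by_cases hz : radialProfile Ap Bp cp (expSum 1 t) = 0
  · have h3 : radialProfile Am Bm cm (expSum (-1) t) ≠ 0 := by
      intro h4
      simp only [hz, h4] at ht
      norm_num at ht
    have := fderiv_radialProfile_radial_pos hcm (hm.two_le hμ.le) h3
    linarith
  · have := fderiv_radialProfile_radial_pos hcp (hp.two_le hμ.le) hz
    linarith

lemma abs_lt_of_wormEta_lt_one (hp : WormParams μ Ap Bp) (hm : WormParams μ Am Bm)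
    (hcp : 0 < cp) (hcm : 0 < cm) {ν : ℝ} (h1 : 2 * Real.log Ap ≤ ν) (h2 : 2 * Real.log Am ≤ ν)
    {t : ℝ × ℝ} (ht : wormEta Ap Am Bp Bm cp cm t < 1) : |t.1| < ν ∧ |t.2| < ν := by
  obtain ⟨ha, hb⟩ := expSum_lt_of_wormEta_lt_one hp hm hcp hcm ht
  have h3 := mul_lt_log_of_expSum_lt ha
  have h4 := mul_lt_log_of_expSum_lt hb
  rw [Real.log_pow] at h3 h4
  push_cast at h3 h4
  rw [abs_lt, abs_lt]
  exact ⟨⟨by linarith, by linarith⟩, by linarith, by linarith⟩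

lemma wormBounded_wormEta (hp : WormParams μ Ap Bp) (hm : WormParams μ Am Bm)
    (hcp : 0 < cp) (hcm : 0 < cm) : WormBounded (wormEta Ap Am Bp Bm cp cm) := by
  -- The `+ 1` turns the weak bounds on the exponential sums into the strict ones needed for the
  -- logarithms.
  refine (Metric.isBounded_closedBall (x := (0 : ℝ × ℝ))
    (r := max (Real.log (Ap ^ 2 + 1)) (Real.log (Am ^ 2 + 1)))).subset fun t ht => ?_
  obtain ⟨ha, hb⟩ := expSum_le_of_wormEta_le_one hp hm hcp hcm ht.2
  have h3 := mul_lt_log_of_expSum_lt (ha.trans_lt (lt_add_one _))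
  have h4 := mul_lt_log_of_expSum_lt (hb.trans_lt (lt_add_one _))
  have h5 := le_max_left (Real.log (Ap ^ 2 + 1)) (Real.log (Am ^ 2 + 1))
  have h6 := le_max_right (Real.log (Ap ^ 2 + 1)) (Real.log (Am ^ 2 + 1))
  rw [mem_closedBall_zero_iff, Prod.norm_def, Real.norm_eq_abs, Real.norm_eq_abs]
  refine max_le (abs_le.2 ⟨?_, ?_⟩) (abs_le.2 ⟨?_, ?_⟩) <;> linarith

lemma isSmoothlyBoundedDomain_wormEta (hμ : 0 < μ) (hp : WormParams μ Ap Bp)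
    (hm : WormParams μ Am Bm) (hcp : 0 < cp) (hcm : 0 < cm) :
    IsSmoothlyBoundedDomain (wormDomain (wormEta Ap Am Bp Bm cp cm)) := by
  have hη := contDiff_wormEta (Ap := Ap) (Am := Am) (Bp := Bp) (Bm := Bm) hcp hcm
  have hM : ∀ t, wormEta Ap Am Bp Bm cp cm t < 1 →
      |t.1| ≤ max (2 * Real.log Ap) (2 * Real.log Am) ∧
      |t.2| ≤ max (2 * Real.log Ap) (2 * Real.log Am) := fun t ht =>
    (abs_lt_of_wormEta_lt_one hp hm hcp hcm (le_max_left _ _) (le_max_right _ _) ht).imp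
      le_of_lt le_of_lt
  exact ⟨⟨isOpen_wormDomain hη, isConnected_wormDomain hη.continuous
      (isPathConnected_wormEta_lt_one hμ hp hm hcp hcm).isConnected⟩,
    isBounded_wormDomain (wormEta_nonneg hcp hcm) hM,
    hasSmoothBoundary_wormDomain hη (wormRegular_wormEta hμ hp hm hcp hcm) hM⟩

lemma mem_truncatedWorm {ν : ℝ} {z : ℂ × ℂ × ℂ} : z ∈ truncatedWorm ν ↔
    z.2.1 ≠ 0 ∧ z.2.2 ≠ 0 ∧ logPair z ∈ Set.Ioo (-ν) ν ×ˢ Set.Ioo (-ν) ν ∧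
      ‖z.1 - wormCenter z‖ ^ 2 < 1 := by
  rw [truncatedWorm, mem_wormDomain]
  refine and_congr_right fun _ => and_congr_right fun _ => ?_
  unfold wormFn
  by_cases h : logPair z ∈ Set.Ioo (-ν) ν ×ˢ Set.Ioo (-ν) ν
  · rw [Set.indicator_of_notMem (Set.notMem_compl_iff.2 h)]
    simp only [h, true_and]
    constructor <;> intro <;> linarith
  · rw [Set.indicator_of_mem (show logPair z ∈ (Set.Ioo (-ν) ν ×ˢ Set.Ioo (-ν) ν)ᶜ from h)]
    refine iff_of_false ?_ (fun h' => h h'.1)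
    have := sq_nonneg ‖z.1 - wormCenter z‖
    linarith

lemma truncatedWorm_subset_wormDomain (hp : WormParams μ Ap Bp)
    (hm : WormParams μ Am Bm) (hcp : 0 < cp) (hcm : 0 < cm) :
    truncatedWorm μ ⊆ wormDomain (wormEta Ap Am Bp Bm cp cm) := by
  intro z hz
  obtain ⟨h2, h3, ht, hr⟩ := mem_truncatedWorm.1 hz
  refine mem_wormDomain.2 ⟨h2, h3, ?_⟩
  rw [wormFn, wormEta_eq_zero hp hm hcp hcm ht]
  linarith

lemma wormDomain_subset_truncatedWorm (hp : WormParams μ Ap Bp) (hm : WormParams μ Am Bm)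
    (hcp : 0 < cp) (hcm : 0 < cm) {ν : ℝ} (h1 : 2 * Real.log Ap ≤ ν) (h2 : 2 * Real.log Am ≤ ν) :
    wormDomain (wormEta Ap Am Bp Bm cp cm) ⊆ truncatedWorm ν := by
  intro z hz
  have hlt := abs_lt_of_wormEta_lt_one hp hm hcp hcm h1 h2 (lt_one_of_mem_wormDomain hz)
  obtain ⟨hz2, hz3, hr⟩ := mem_wormDomain.1 hz
  refine mem_truncatedWorm.2 ⟨hz2, hz3, ⟨abs_lt.1 hlt.1, abs_lt.1 hlt.2⟩, ?_⟩
  have := wormEta_nonneg (Ap := Ap) (Am := Am) (Bp := Bp) (Bm := Bm) hcp hcm (logPair z)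
  unfold wormFn at hr
  linarith

/-! ### Levi positivity of the explicit profile and membership in the class. -/

/-- The set `{e^{t₂} + e^{t₃} < 2 A₊², e^{-t₂} + e^{-t₃} < 2 A₋²}`, a neighborhood of
`η⁻¹([0, 1])`. -/
def wormRegion (Ap Am : ℝ) : Set (ℝ × ℝ) :=
  {t | expSum 1 t < 2 * Ap ^ 2 ∧ expSum (-1) t < 2 * Am ^ 2}

lemma isOpen_wormRegion (Ap Am : ℝ) : IsOpen (wormRegion Ap Am) :=
  (isOpen_lt (contDiff_expSum 1).continuous continuous_const).inter
    (isOpen_lt (contDiff_expSum (-1)).continuous continuous_const)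

lemma mem_wormRegion_of_le_one (hp : WormParams μ Ap Bp) (hm : WormParams μ Am Bm)
    (hcp : 0 < cp) (hcm : 0 < cm) {t : ℝ × ℝ} (ht : wormEta Ap Am Bp Bm cp cm t ≤ 1) :
    t ∈ wormRegion Ap Am := by
  obtain ⟨ha, hb⟩ := expSum_le_of_wormEta_le_one hp hm hcp hcm ht
  have := hp.pos
  have := hm.pos
  exact ⟨by nlinarith, by nlinarith⟩

/-- A lower bound for the constants `c` in terms of bounds `K` and `L` for the exponential sums
of both signs. -/
def levelBound (K L : ℝ) : ℝ := 4 * K + K ^ 3 * L ^ 2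

/-- The bound `L` on the sum of opposite sign gives `e^{s tⱼ} ≥ 1/L`, so `m = L⁻¹` works. The two
summands of `levelBound` are then the two lower bounds required of `c`. -/
lemma leviNonneg_signed {A B c s K L : ℝ} (hs : s ^ 2 = 1) (hK : 0 < K) (hL : 0 < L)
    (hc : levelBound K L ≤ c) {t : ℝ × ℝ} (h1 : expSum s t ≤ K) (h2 : expSum (-s) t ≤ L) :
    LeviNonneg (fun t => radialProfile A B c (expSum s t)) t := by
  unfold levelBound at hc
  have hKL : 0 < K ^ 3 * L ^ 2 := by positivity
  have key : ∀ x, Real.exp (-s * x) ≤ L → L⁻¹ ≤ Real.exp (s * x) := fun x hx => by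
    rw [← neg_neg (s * x), Real.exp_neg (-(s * x)), ← neg_mul]
    exact inv_anti₀ (Real.exp_pos _) hx
  have e1 := Real.exp_pos (-s * t.1)
  have e2 := Real.exp_pos (-s * t.2)
  unfold expSum at h2
  refine leviNonneg_radialProfile (m := L⁻¹) (K := K) (by linarith) hs (by positivity) hK
    (by linarith) ?_ (key _ (by linarith)) (key _ (by linarith)) h1
  rw [inv_pow, ← div_eq_mul_inv, le_div_iff₀ (by positivity)]
  linarith

lemma leviNonneg_wormEta (hp : WormParams μ Ap Bp) (hm : WormParams μ Am Bm)
    (hcp : levelBound (2 * Ap ^ 2) (2 * Am ^ 2) ≤ cp)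
    (hcm : levelBound (2 * Am ^ 2) (2 * Ap ^ 2) ≤ cm) {t : ℝ × ℝ} (ht : t ∈ wormRegion Ap Am) :
    LeviNonneg (wormEta Ap Am Bp Bm cp cm) t := by
  have h1 : 0 < 2 * Ap ^ 2 := by have := hp.pos; positivity
  have h2 : 0 < 2 * Am ^ 2 := by have := hm.pos; positivity
  have h3 : 0 < levelBound (2 * Ap ^ 2) (2 * Am ^ 2) := by unfold levelBound; positivity
  have h4 : 0 < levelBound (2 * Am ^ 2) (2 * Ap ^ 2) := by unfold levelBound; positivity
  rw [wormEta_eq (h3.trans_le hcp) (h4.trans_le hcm)]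
  refine LeviNonneg.add (contDiff_comp_expSum (contDiff_radialProfile _ _ _) _)
    (contDiff_comp_expSum (contDiff_radialProfile _ _ _) _)
    (leviNonneg_signed (by norm_num) h1 h2 hcp ht.1.le ht.2.le)
    (leviNonneg_signed (by norm_num) h2 h1 hcm ht.2.le ?_)
  rw [neg_neg]; exact ht.1.le

lemma wormInequalitiesNearBoundary_wormEta (hp : WormParams μ Ap Bp)
    (hm : WormParams μ Am Bm) (hcp : levelBound (2 * Ap ^ 2) (2 * Am ^ 2) ≤ cp)
    (hcm : levelBound (2 * Am ^ 2) (2 * Ap ^ 2) ≤ cm) (hcp0 : 0 < cp) (hcm0 : 0 < cm) :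
    WormInequalitiesNearBoundary (wormEta Ap Am Bp Bm cp cm) := by
  have hcont : ContinuousOn logPair {z : ℂ × ℂ × ℂ | z.2.1 ≠ 0 ∧ z.2.2 ≠ 0} := fun z hz =>
    (contDiffAt_logPair hz.1 hz.2).continuousAt.continuousWithinAt
  refine ⟨_, hcont.isOpen_inter_preimage isOpen_ne_zero (isOpen_wormRegion Ap Am), ?_, ?_⟩
  · intro z hz
    have hη := contDiff_wormEta (Ap := Ap) (Am := Am) (Bp := Bp) (Bm := Bm) hcp0 hcm0
    obtain ⟨hb, hr⟩ := mem_logBox_of_mem_frontier hη (fun t ht =>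
      (abs_lt_of_wormEta_lt_one hp hm hcp0 hcm0 (le_max_left _ _) (le_max_right _ _) ht).imp
        le_of_lt le_of_lt) hz
    refine ⟨ne_zero_of_mem_logBox hb, mem_wormRegion_of_le_one hp hm hcp0 hcm0 ?_⟩
    unfold wormFn at hr
    nlinarith [sq_nonneg ‖z.1 - wormCenter z‖]
  · intro z hz _ _
    have := leviNonneg_wormEta hp hm hcp hcm hz.2
    exact ⟨this.wormInequalityOne, this.wormInequalityTwo⟩

lemma wormDomain_mem_wormClass (hμ : 0 < μ) (hp : WormParams μ Ap Bp)
    (hm : WormParams μ Am Bm) (hcp : levelBound (2 * Ap ^ 2) (2 * Am ^ 2) ≤ cp)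
    (hcm : levelBound (2 * Am ^ 2) (2 * Ap ^ 2) ≤ cm) (hcp0 : 0 < cp) (hcm0 : 0 < cm) :
    wormDomain (wormEta Ap Am Bp Bm cp cm) ∈ wormClass μ :=
  ⟨_, isWormProfile_wormEta hμ hp hm hcp0 hcm0,
    ⟨Set.univ, isOpen_univ, Set.subset_univ _, (contDiff_wormEta hcp0 hcm0).contDiffOn⟩,
    wormRegular_wormEta hμ hp hm hcp0 hcm0, wormBounded_wormEta hp hm hcp0 hcm0,
    wormInequalitiesNearBoundary_wormEta hp hm hcp hcm hcp0 hcm0, rfl⟩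

end Parameters

/-! ### A sub-mean value inequality in logarithmic coordinates -/

lemma continuous_line (s : ℝ) : Continuous fun θ : ℝ => (s : ℂ) + θ * Complex.I := by fun_prop

lemma re_line (s θ : ℝ) : ((s : ℂ) + θ * Complex.I).re = s := by simp

lemma continuous_comp_line {δ s : ℝ} {F : ℂ → ℝ} (hF : ContinuousOn F {w | w.re < δ})
    (hs : s < δ) : Continuous fun θ : ℝ => F ((s : ℂ) + θ * Complex.I) := by
  refine continuousOn_univ.1 (hF.comp (continuous_line s).continuousOn fun θ _ => ?_)
  rw [Set.mem_ofPred_eq, re_line]; exact hs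

lemma hasDerivAt_integral_line {δ s : ℝ} {F F' : ℂ → ℝ} (hF : ContinuousOn F {w | w.re < δ})
    (hF' : ContinuousOn F' {w | w.re < δ})
    (h : ∀ s θ : ℝ, s < δ →
      HasDerivAt (fun s : ℝ => F (s + θ * Complex.I)) (F' (s + θ * Complex.I)) s) (hs : s < δ) :
    HasDerivAt (fun s : ℝ => ∫ θ in (0 : ℝ)..(2 * Real.pi), F (s + θ * Complex.I))
      (∫ θ in (0 : ℝ)..(2 * Real.pi), F' (s + θ * Complex.I)) s := by
  set ε := (δ - s) / 2 with hε
  have hε0 : 0 < ε := by rw [hε]; linarith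
  have hK : IsCompact (Set.Icc (s - ε) (s + ε) ×ˢ Set.uIcc 0 (2 * Real.pi)) :=
    isCompact_Icc.prod isCompact_uIcc
  have hcont : ContinuousOn (fun p : ℝ × ℝ => F' ((p.1 : ℂ) + p.2 * Complex.I))
      (Set.Icc (s - ε) (s + ε) ×ˢ Set.uIcc 0 (2 * Real.pi)) := by
    refine hF'.comp (by fun_prop) fun p hp => ?_
    rw [Set.mem_ofPred_eq, re_line]
    have := hp.1.2
    linarith
  obtain ⟨C, hC⟩ := hK.exists_bound_of_continuousOn hcont
  refine (intervalIntegral.hasDerivAt_integral_of_dominated_loc_of_deriv_le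
    (F := fun (s : ℝ) (θ : ℝ) => F (s + θ * Complex.I))
    (F' := fun (s : ℝ) (θ : ℝ) => F' (s + θ * Complex.I))
    (bound := fun _ => C) (Metric.ball_mem_nhds s hε0) ?_ ?_ ?_ ?_ ?_ ?_).2
  · filter_upwards [Iio_mem_nhds hs] with x hx
    exact (continuous_comp_line hF (Set.mem_Iio.1 hx)).aestronglyMeasurable
  · exact (continuous_comp_line hF hs).intervalIntegrable _ _
  · exact (continuous_comp_line hF' hs).aestronglyMeasurable
  · refine Filter.Eventually.of_forall fun θ hθ x hx => hC (x, θ) ⟨?_, Set.uIoc_subset_uIcc hθ⟩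
    rw [Metric.mem_ball, Real.dist_eq, abs_lt] at hx
    exact ⟨by linarith, by linarith⟩
  · exact intervalIntegrable_const
  · refine Filter.Eventually.of_forall fun θ _ x hx => h x θ ?_
    rw [Metric.mem_ball, Real.dist_eq, abs_lt] at hx
    linarith

lemma circleMap_exp (s θ : ℝ) :
    circleMap 0 (Real.exp s) θ = Complex.exp (s + θ * Complex.I) := by
  rw [circleMap, zero_add, Complex.exp_add, Complex.ofReal_exp]

/-- If the slope of the convex function `m` were negative somewhere, `m` would lie above the tangent
there and tend to `+∞` at `-∞`, against the finite limit. -/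
lemma monotoneOn_of_convex_bounded {δ l : ℝ} {m m' m'' : ℝ → ℝ}
    (h1 : ∀ s < δ, HasDerivAt m (m' s) s) (h2 : ∀ s < δ, HasDerivAt m' (m'' s) s)
    (h3 : ∀ s < δ, 0 ≤ m'' s) (hl : Filter.Tendsto m Filter.atBot (nhds l)) :
    MonotoneOn m (Set.Iio δ) := by
  have hm' : MonotoneOn m' (Set.Iio δ) := by
    refine monotoneOn_of_hasDerivWithinAt_nonneg (f' := m'') (convex_Iio δ)
      (fun s hs => (h2 s hs).continuousAt.continuousWithinAt) ?_ ?_ <;>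
    · intro s hs
      rw [interior_Iio] at hs
      first | exact h3 s hs | exact (h2 s hs).hasDerivWithinAt
  have hpos : ∀ s < δ, 0 ≤ m' s := by
    intro s hs
    by_contra! hneg
    have hanti : AntitoneOn (fun x => m x - m' s * x) (Set.Iic s) := by
      refine antitoneOn_of_hasDerivWithinAt_nonpos (f' := fun x => m' x - m' s) (convex_Iic s)
        (fun x hx => ?_) ?_ ?_
      · have hx' : x < δ := lt_of_le_of_lt hx hs
        exact ((h1 x hx').continuousAt.sub (by fun_prop)).continuousWithinAt
      · intro x hx
        rw [interior_Iic] at hx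
        have := (h1 x (lt_trans hx hs)).sub ((hasDerivAt_id x).const_mul (m' s))
        rw [mul_one] at this
        exact this.hasDerivWithinAt
      · intro x hx
        rw [interior_Iic] at hx
        have := hm' (show x ∈ Set.Iio δ from lt_trans hx hs) hs (le_of_lt hx)
        linarith
    have hlin : Filter.Tendsto (fun x => m' s * x + (m s - m' s * s)) Filter.atBot Filter.atTop :=
      Filter.tendsto_atTop_add_const_right _ _ (Filter.tendsto_id.const_mul_atBot_of_neg hneg)
    have htop : Filter.Tendsto m Filter.atBot Filter.atTop := by
      refine Filter.tendsto_atTop_mono' _ ?_ hlin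
      filter_upwards [Filter.eventually_le_atBot s] with x hx
      have := hanti (show x ∈ Set.Iic s from hx) (Set.mem_Iic.2 le_rfl) hx
      simp only at this
      linarith
    exact not_tendsto_nhds_of_tendsto_atTop htop l hl
  refine monotoneOn_of_hasDerivWithinAt_nonneg (f' := m') (convex_Iio δ)
    (fun s hs => (h1 s hs).continuousAt.continuousWithinAt) ?_ ?_ <;>
  · intro s hs
    rw [interior_Iio] at hs
    first | exact hpos s hs | exact (h1 s hs).hasDerivWithinAt

/-- The sub-mean value inequality at the centre of the unit disk for a function whose pullback by
the exponential map is subharmonic. -/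
lemma le_circleAverage_of_laplacian_exp_nonneg {g : ℂ → ℝ} {R : ℝ} (hR : 1 < R)
    (hg : ContinuousOn g (Metric.ball 0 R)) {Gs Gss Gθ Gθθ : ℂ → ℝ}
    (hs : ∀ s θ : ℝ, s < Real.log R → HasDerivAt
      (fun s : ℝ => g (Complex.exp (s + θ * Complex.I))) (Gs (s + θ * Complex.I)) s)
    (hss : ∀ s θ : ℝ, s < Real.log R → HasDerivAt
      (fun s : ℝ => Gs (s + θ * Complex.I)) (Gss (s + θ * Complex.I)) s)
    (hθθ : ∀ s θ : ℝ, s < Real.log R → HasDerivAt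
      (fun θ : ℝ => Gθ (s + θ * Complex.I)) (Gθθ (s + θ * Complex.I)) θ)
    (hcs : ContinuousOn Gs {w | w.re < Real.log R})
    (hcss : ContinuousOn Gss {w | w.re < Real.log R})
    (hcθθ : ContinuousOn Gθθ {w | w.re < Real.log R})
    (hper : ∀ s : ℝ, Gθ (s + (2 * Real.pi : ℝ) * Complex.I) = Gθ (s + (0 : ℝ) * Complex.I))
    (hpos : ∀ w : ℂ, w.re < Real.log R → 0 ≤ Gss w + Gθθ w) :
    g 0 ≤ Real.circleAverage g 0 1 := by
  have hR0 : 0 < R := by linarith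
  have hδ : 0 < Real.log R := Real.log_pos hR
  have hG : ContinuousOn (fun w => g (Complex.exp w)) {w | w.re < Real.log R} := by
    refine hg.comp Complex.continuous_exp.continuousOn fun w hw => ?_
    rw [mem_ball_zero_iff, Complex.norm_exp]
    exact (Real.lt_log_iff_exp_lt hR0).1 hw
  have hm : ∀ s : ℝ, Real.circleAverage g 0 (Real.exp s) = (2 * Real.pi)⁻¹ *
      ∫ θ in (0 : ℝ)..(2 * Real.pi), g (Complex.exp (s + θ * Complex.I)) := fun s => by
    simp only [Real.circleAverage_def, circleMap_exp, smul_eq_mul]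
  -- In the variable `s = log (radius)` the circle average is a mean over `θ` of the pullback. Its
  -- second derivative is the mean of `Gss`, so convexity in `s` replaces the Laplacian in polar
  -- coordinates and its singularity at 0.
  have h1 : ∀ s < Real.log R, HasDerivAt (fun s => Real.circleAverage g 0 (Real.exp s)) _ s :=
    fun s h => ((hasDerivAt_integral_line hG hcs hs h).const_mul
      (2 * Real.pi)⁻¹).congr_of_eventuallyEq (Filter.Eventually.of_forall hm)
  have h2 := fun s h => (hasDerivAt_integral_line hcs hcss hss h).const_mul (2 * Real.pi)⁻¹ (x := s)
  have h3 : ∀ s < Real.log R,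
      0 ≤ (2 * Real.pi)⁻¹ * ∫ θ in (0 : ℝ)..(2 * Real.pi), Gss (s + θ * Complex.I) := by
    intro s h
    refine mul_nonneg (by positivity) ?_
    -- Periodicity in `θ` kills the mean of `Gθθ`, so it may be added to that of `Gss` to produce
    -- the Laplacian.
    have hzero : ∫ θ in (0 : ℝ)..(2 * Real.pi), Gθθ (s + θ * Complex.I) = 0 := by
      rw [intervalIntegral.integral_eq_sub_of_hasDerivAt (fun θ _ => hθθ s θ h)
        ((continuous_comp_line hcθθ h).intervalIntegrable _ _), hper, sub_self]
    have hadd := intervalIntegral.integral_add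
      ((continuous_comp_line hcss h).intervalIntegrable (μ := MeasureTheory.volume) 0 (2 * Real.pi))
      ((continuous_comp_line hcθθ h).intervalIntegrable 0 (2 * Real.pi))
    rw [hzero, add_zero] at hadd
    rw [← hadd]
    refine intervalIntegral.integral_nonneg (by positivity) fun θ _ => hpos _ ?_
    rw [re_line]; exact h
  have hlim : Filter.Tendsto (fun s => Real.circleAverage g 0 (Real.exp s)) Filter.atBot
      (nhds (g 0)) := by
    have hc : ContinuousOn (Real.circleAverage g 0) (Set.Ico 0 R) := by
      refine Real.ContinuousOn.circleAverage (hg.mono fun z hz => ?_) fun r hr => hr.1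
      have := hz.2
      simpa using this
    have h0 : Filter.Tendsto (Real.circleAverage g 0) (nhdsWithin 0 (Set.Ico 0 R)) (nhds (g 0)) := by
      simpa using (hc 0 ⟨le_rfl, hR0⟩).tendsto
    refine h0.comp (tendsto_nhdsWithin_iff.2 ⟨Real.tendsto_exp_atBot, ?_⟩)
    filter_upwards [Filter.eventually_lt_atBot (Real.log R)] with s h
    exact ⟨(Real.exp_pos s).le, (Real.lt_log_iff_exp_lt hR0).1 h⟩
  have hmono := monotoneOn_of_convex_bounded h1 h2 h3 hlim
  have hle := le_of_tendsto hlim (b := Real.circleAverage g 0 (Real.exp 0)) (by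
    filter_upwards [Filter.eventually_le_atBot 0] with s h
    exact hmono (lt_of_le_of_lt h hδ) hδ h)
  rwa [Real.exp_zero] at hle

/-! ### The Levi form and plurisubharmonicity -/

/-- The Hermitian form of the Levi matrix at `(a, b)`. The off-diagonal part is controlled by
Cauchy–Schwarz and the determinant condition, then absorbed by the diagonal through the inequality
of arithmetic and geometric means. -/
lemma LeviNonneg.form_nonneg {η : ℝ × ℝ → ℝ} {t : ℝ × ℝ} (h : LeviNonneg η t) (a b : ℂ) :
    0 ≤ (η t + partialTwo (partialTwo η) t) * (a.re ^ 2 + a.im ^ 2)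
      + (η t + partialThree (partialThree η) t) * (b.re ^ 2 + b.im ^ 2)
      + 2 * (partialTwo (partialThree η) t + η t) * (a.re * b.re + a.im * b.im)
      + 2 * (partialTwo η t - partialThree η t) * (a.re * b.im - a.im * b.re) := by
  obtain ⟨h1, h2, h3⟩ := h
  set P := η t + partialTwo (partialTwo η) t
  set Q := η t + partialThree (partialThree η) t
  set X := partialTwo (partialThree η) t + η t
  set Y := partialTwo η t - partialThree η t
  set U := a.re * b.re + a.im * b.im with hU
  set V := a.re * b.im - a.im * b.re with hV
  have hUV : U ^ 2 + V ^ 2 = (a.re ^ 2 + a.im ^ 2) * (b.re ^ 2 + b.im ^ 2) := by rw [hU, hV]; ring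
  set n := a.re ^ 2 + a.im ^ 2 with hn
  set k := b.re ^ 2 + b.im ^ 2 with hk
  have hn0 : 0 ≤ n := by positivity
  have hk0 : 0 ≤ k := by positivity
  have hsq : (X * U + Y * V) ^ 2 ≤ (P * n) * (Q * k) := by
    calc (X * U + Y * V) ^ 2 ≤ (X ^ 2 + Y ^ 2) * (U ^ 2 + V ^ 2) := by
          nlinarith [sq_nonneg (X * V - Y * U)]
      _ ≤ (P * Q) * (n * k) := by rw [hUV]; gcongr
      _ = _ := by ring
  have hP : 0 ≤ P * n := by positivity
  have hQ : 0 ≤ Q * k := by positivity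
  have := abs_le_of_sq_le_sq (a := 2 * (X * U + Y * V)) (b := P * n + Q * k)
    (by nlinarith [sq_nonneg (P * n - Q * k)]) (by positivity)
  linarith [(abs_le.1 this).1]

lemma hasDerivAt_re_comp {k : ℂ → ℂ} {γ : ℝ → ℂ} {l d : ℂ} {s : ℝ} (hk : HasDerivAt k l (γ s))
    (hγ : HasDerivAt γ d s) : HasDerivAt (fun s => (k (γ s)).re) (l * d).re s := by
  have h : HasDerivAt (fun s => k (γ s)) (l * d) s :=
    (hk.scomp s hγ).congr_deriv (mul_comm _ _)
  exact Complex.reCLM.hasFDerivAt.comp_hasDerivAt s h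

lemma hasDerivAt_im_comp {k : ℂ → ℂ} {γ : ℝ → ℂ} {l d : ℂ} {s : ℝ} (hk : HasDerivAt k l (γ s))
    (hγ : HasDerivAt γ d s) : HasDerivAt (fun s => (k (γ s)).im) (l * d).im s := by
  have h : HasDerivAt (fun s => k (γ s)) (l * d) s :=
    (hk.scomp s hγ).congr_deriv (mul_comm _ _)
  exact Complex.imCLM.hasFDerivAt.comp_hasDerivAt s h

section Laplacian

/-- The pair `(2 Re k₂, 2 Re k₃)`. -/
def rePair (k₂ k₃ : ℂ → ℂ) (w : ℂ) : ℝ × ℝ := (2 * (k₂ w).re, 2 * (k₃ w).re)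

/-- The function `η(2 Re k₂, 2 Re k₃) e^{2 Im (k₂ + k₃)}`. -/
def twisted (η : ℝ × ℝ → ℝ) (k₂ k₃ : ℂ → ℂ) (w : ℂ) : ℝ :=
  Real.exp (2 * ((k₂ w).im + (k₃ w).im)) * η (rePair k₂ k₃ w)

/-- The derivative of `twisted η k₂ k₃` in the direction `d`, where `l₂` and `l₃` are the
derivatives of `k₂` and `k₃`. -/
def twistedD (η : ℝ × ℝ → ℝ) (k₂ k₃ l₂ l₃ : ℂ → ℂ) (d w : ℂ) : ℝ :=
  Real.exp (2 * ((k₂ w).im + (k₃ w).im)) *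
    (partialTwo η (rePair k₂ k₃ w) * (2 * (l₂ w * d).re)
      + partialThree η (rePair k₂ k₃ w) * (2 * (l₃ w * d).re)
      + η (rePair k₂ k₃ w) * (2 * ((l₂ w * d).im + (l₃ w * d).im)))

/-- The second derivative of `twisted η k₂ k₃` in the direction `d`, where `lⱼ` and `nⱼ` are the
first and second derivatives of `kⱼ`. -/
def twistedDD (η : ℝ × ℝ → ℝ) (k₂ k₃ l₂ l₃ n₂ n₃ : ℂ → ℂ) (d w : ℂ) : ℝ :=
  Real.exp (2 * ((k₂ w).im + (k₃ w).im)) *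
    (partialTwo (partialTwo η) (rePair k₂ k₃ w) * (2 * (l₂ w * d).re) ^ 2
      + 2 * partialTwo (partialThree η) (rePair k₂ k₃ w) * (2 * (l₂ w * d).re) * (2 * (l₃ w * d).re)
      + partialThree (partialThree η) (rePair k₂ k₃ w) * (2 * (l₃ w * d).re) ^ 2
      + partialTwo η (rePair k₂ k₃ w) * (2 * (n₂ w * d * d).re)
      + partialThree η (rePair k₂ k₃ w) * (2 * (n₃ w * d * d).re)
      + η (rePair k₂ k₃ w) * (2 * ((n₂ w * d * d).im + (n₃ w * d * d).im))
      + 2 * (2 * ((l₂ w * d).im + (l₃ w * d).im)) *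
        (partialTwo η (rePair k₂ k₃ w) * (2 * (l₂ w * d).re)
          + partialThree η (rePair k₂ k₃ w) * (2 * (l₃ w * d).re))
      + η (rePair k₂ k₃ w) * (2 * ((l₂ w * d).im + (l₃ w * d).im)) ^ 2)

variable {η : ℝ × ℝ → ℝ} {k₂ k₃ l₂ l₃ n₂ n₃ : ℂ → ℂ} {γ : ℝ → ℂ} {d : ℂ} {s : ℝ}

lemma hasDerivAt_comp_rePair {f : ℝ × ℝ → ℝ} (hf : ContDiff ℝ ∞ f)
    (h2 : HasDerivAt k₂ (l₂ (γ s)) (γ s)) (h3 : HasDerivAt k₃ (l₃ (γ s)) (γ s))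
    (hγ : HasDerivAt γ d s) :
    HasDerivAt (fun s => f (rePair k₂ k₃ (γ s)))
      (partialTwo f (rePair k₂ k₃ (γ s)) * (2 * (l₂ (γ s) * d).re)
        + partialThree f (rePair k₂ k₃ (γ s)) * (2 * (l₃ (γ s) * d).re)) s :=
  hasDerivAt_comp_prod (x := fun s => 2 * (k₂ (γ s)).re) (y := fun s => 2 * (k₃ (γ s)).re)
    (hf.differentiable (by simp) _) ((hasDerivAt_re_comp h2 hγ).const_mul 2)
    ((hasDerivAt_re_comp h3 hγ).const_mul 2)

lemma hasDerivAt_exp_im (h2 : HasDerivAt k₂ (l₂ (γ s)) (γ s))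
    (h3 : HasDerivAt k₃ (l₃ (γ s)) (γ s)) (hγ : HasDerivAt γ d s) :
    HasDerivAt (fun s => Real.exp (2 * ((k₂ (γ s)).im + (k₃ (γ s)).im)))
      (Real.exp (2 * ((k₂ (γ s)).im + (k₃ (γ s)).im)) *
        (2 * ((l₂ (γ s) * d).im + (l₃ (γ s) * d).im))) s :=
  (((hasDerivAt_im_comp h2 hγ).add (hasDerivAt_im_comp h3 hγ)).const_mul 2).exp

lemma hasDerivAt_twisted (hη : ContDiff ℝ ∞ η) (h2 : HasDerivAt k₂ (l₂ (γ s)) (γ s))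
    (h3 : HasDerivAt k₃ (l₃ (γ s)) (γ s)) (hγ : HasDerivAt γ d s) :
    HasDerivAt (fun s => twisted η k₂ k₃ (γ s)) (twistedD η k₂ k₃ l₂ l₃ d (γ s)) s := by
  have h := (hasDerivAt_exp_im h2 h3 hγ).mul (hasDerivAt_comp_rePair hη h2 h3 hγ)
  refine h.congr_deriv ?_
  unfold twistedD
  ring

lemma hasDerivAt_twistedD (hη : ContDiff ℝ ∞ η) (h2 : HasDerivAt k₂ (l₂ (γ s)) (γ s))
    (h3 : HasDerivAt k₃ (l₃ (γ s)) (γ s)) (h2' : HasDerivAt l₂ (n₂ (γ s)) (γ s))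
    (h3' : HasDerivAt l₃ (n₃ (γ s)) (γ s)) (hγ : HasDerivAt γ d s) :
    HasDerivAt (fun s => twistedD η k₂ k₃ l₂ l₃ d (γ s))
      (twistedDD η k₂ k₃ l₂ l₃ n₂ n₃ d (γ s)) s := by
  have e2 : HasDerivAt (fun s => 2 * (l₂ (γ s) * d).re) (2 * (n₂ (γ s) * d * d).re) s :=
    (hasDerivAt_re_comp (h2'.mul_const d) hγ).const_mul 2
  have e3 : HasDerivAt (fun s => 2 * (l₃ (γ s) * d).re) (2 * (n₃ (γ s) * d * d).re) s :=
    (hasDerivAt_re_comp (h3'.mul_const d) hγ).const_mul 2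
  have f2 : HasDerivAt (fun s => (l₂ (γ s) * d).im) (n₂ (γ s) * d * d).im s :=
    hasDerivAt_im_comp (h2'.mul_const d) hγ
  have f3 : HasDerivAt (fun s => (l₃ (γ s) * d).im) (n₃ (γ s) * d * d).im s :=
    hasDerivAt_im_comp (h3'.mul_const d) hγ
  have h := (hasDerivAt_exp_im h2 h3 hγ).mul
    ((((hasDerivAt_comp_rePair hη.partialTwo h2 h3 hγ).mul e2).add
      ((hasDerivAt_comp_rePair hη.partialThree h2 h3 hγ).mul e3)).add
      ((hasDerivAt_comp_rePair hη h2 h3 hγ).mul ((f2.add f3).const_mul 2)))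
  refine h.congr_deriv ?_
  simp only [Pi.add_apply, Pi.mul_apply]
  rw [partialThree_partialTwo hη]
  unfold twistedDD
  ring

/-- Since `1² + i² = 0`, the terms containing second derivatives of `k₂` and `k₃` cancel. What is
left is `4 e^{2 Im (k₂ + k₃)}` times the Levi form at `(l₂, l₃)`. -/
lemma twistedDD_add_nonneg {w : ℂ} (h : LeviNonneg η (rePair k₂ k₃ w)) :
    0 ≤ twistedDD η k₂ k₃ l₂ l₃ n₂ n₃ 1 w + twistedDD η k₂ k₃ l₂ l₃ n₂ n₃ Complex.I w := by
  have hf := h.form_nonneg (l₂ w) (l₃ w)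
  have hE := Real.exp_pos (2 * ((k₂ w).im + (k₃ w).im))
  have := mul_nonneg hE.le hf
  unfold twistedDD
  simp only [mul_one, Complex.mul_re, Complex.mul_im, Complex.I_re, Complex.I_im]
  linarith

variable {S : Set ℂ}

lemma continuousOn_rePair (h2 : ContinuousOn k₂ S) (h3 : ContinuousOn k₃ S) :
    ContinuousOn (rePair k₂ k₃) S := by
  unfold rePair
  fun_prop

lemma continuousOn_twisted (hη : ContDiff ℝ ∞ η) (h2 : ContinuousOn k₂ S)
    (h3 : ContinuousOn k₃ S) : ContinuousOn (twisted η k₂ k₃) S := by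
  have := continuousOn_rePair h2 h3
  have := hη.continuous
  unfold twisted
  fun_prop

lemma continuousOn_twistedD (hη : ContDiff ℝ ∞ η) (h2 : ContinuousOn k₂ S)
    (h3 : ContinuousOn k₃ S) (h2' : ContinuousOn l₂ S) (h3' : ContinuousOn l₃ S) :
    ContinuousOn (twistedD η k₂ k₃ l₂ l₃ d) S := by
  have := continuousOn_rePair h2 h3
  have := hη.continuous
  have := hη.partialTwo.continuous
  have := hη.partialThree.continuous
  unfold twistedD
  fun_prop

lemma continuousOn_twistedDD (hη : ContDiff ℝ ∞ η) (h2 : ContinuousOn k₂ S)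
    (h3 : ContinuousOn k₃ S) (h2' : ContinuousOn l₂ S) (h3' : ContinuousOn l₃ S)
    (h2'' : ContinuousOn n₂ S) (h3'' : ContinuousOn n₃ S) :
    ContinuousOn (twistedDD η k₂ k₃ l₂ l₃ n₂ n₃ d) S := by
  have := continuousOn_rePair h2 h3
  have := hη.continuous
  have := hη.partialTwo.continuous
  have := hη.partialThree.continuous
  have := hη.partialTwo.partialTwo.continuous
  have := hη.partialThree.partialTwo.continuous
  have := hη.partialThree.partialThree.continuous
  unfold twistedDD
  fun_prop

end Laplacian

/-- The sub-mean value inequality for `η(2 Re ζ₂, 2 Re ζ₃) e^{2 Im (ζ₂ + ζ₃)}`, where `ζ₂` and `ζ₃`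
are holomorphic in a neighborhood of the closed unit disk. -/
lemma twisted_le_circleAverage {η : ℝ × ℝ → ℝ} (hη : ContDiff ℝ ∞ η) {ζ₂ ζ₃ : ℂ → ℂ} {R : ℝ}
    (hR : 1 < R) (h2 : DifferentiableOn ℂ ζ₂ (Metric.ball 0 R))
    (h3 : DifferentiableOn ℂ ζ₃ (Metric.ball 0 R))
    (hL : ∀ z ∈ Metric.ball (0 : ℂ) R, LeviNonneg η (rePair ζ₂ ζ₃ z)) :
    twisted η ζ₂ ζ₃ 0 ≤ Real.circleAverage (twisted η ζ₂ ζ₃) 0 1 := by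
  have hR0 : 0 < R := by linarith
  have hmem : ∀ w : ℂ, w.re < Real.log R → Complex.exp w ∈ Metric.ball (0 : ℂ) R := fun w hw => by
    rw [mem_ball_zero_iff, Complex.norm_exp]
    exact (Real.lt_log_iff_exp_lt hR0).1 hw
  have hd1 : ∀ ζ : ℂ → ℂ, DifferentiableOn ℂ ζ (Metric.ball 0 R) → ∀ w : ℂ, w.re < Real.log R →
      HasDerivAt (fun w => ζ (Complex.exp w)) (deriv ζ (Complex.exp w) * Complex.exp w) w :=
    fun ζ hζ w hw => ((hζ.differentiableAt
      (Metric.isOpen_ball.mem_nhds (hmem w hw))).hasDerivAt).comp w (Complex.hasDerivAt_exp w)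
  have hd2 : ∀ ζ : ℂ → ℂ, DifferentiableOn ℂ ζ (Metric.ball 0 R) → ∀ w : ℂ, w.re < Real.log R →
      HasDerivAt (fun w => deriv ζ (Complex.exp w) * Complex.exp w)
        (deriv (deriv ζ) (Complex.exp w) * Complex.exp w * Complex.exp w
          + deriv ζ (Complex.exp w) * Complex.exp w) w :=
    fun ζ hζ w hw => (hd1 _ (hζ.deriv Metric.isOpen_ball) w hw).mul (Complex.hasDerivAt_exp w)
  have hmaps : Set.MapsTo Complex.exp {w | w.re < Real.log R} (Metric.ball (0 : ℂ) R) :=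
    fun w hw => hmem w hw
  have c0 : ∀ ζ : ℂ → ℂ, DifferentiableOn ℂ ζ (Metric.ball 0 R) →
      ContinuousOn (fun w => ζ (Complex.exp w)) {w | w.re < Real.log R} :=
    fun ζ hζ => hζ.continuousOn.comp Complex.continuous_exp.continuousOn hmaps
  have c1 : ∀ ζ : ℂ → ℂ, DifferentiableOn ℂ ζ (Metric.ball 0 R) →
      ContinuousOn (fun w => deriv ζ (Complex.exp w) * Complex.exp w) {w | w.re < Real.log R} :=
    fun ζ hζ => (c0 _ (hζ.deriv Metric.isOpen_ball)).mul Complex.continuous_exp.continuousOn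
  have c2 : ∀ ζ : ℂ → ℂ, DifferentiableOn ℂ ζ (Metric.ball 0 R) →
      ContinuousOn (fun w => deriv (deriv ζ) (Complex.exp w) * Complex.exp w * Complex.exp w
          + deriv ζ (Complex.exp w) * Complex.exp w) {w | w.re < Real.log R} :=
    fun ζ hζ => ((c1 _ (hζ.deriv Metric.isOpen_ball)).mul
      Complex.continuous_exp.continuousOn).add (c1 ζ hζ)
  have hγs : ∀ s θ : ℝ, HasDerivAt (fun s : ℝ => (s : ℂ) + θ * Complex.I) 1 s := fun s θ => by
    simpa using (hasDerivAt_id s).ofReal_comp.add_const ((θ : ℂ) * Complex.I)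
  have hγθ : ∀ s θ : ℝ, HasDerivAt (fun θ : ℝ => (s : ℂ) + θ * Complex.I) Complex.I θ :=
    fun s θ => by
      simpa using ((hasDerivAt_id θ).ofReal_comp.mul_const Complex.I).const_add (s : ℂ)
  have hre : ∀ s θ : ℝ, s < Real.log R → ((s : ℂ) + θ * Complex.I).re < Real.log R :=
    fun s θ h => by rwa [re_line]
  -- `kⱼ`, `lⱼ`, `nⱼ` are the pullback `ζⱼ ∘ exp` and its first two complex derivatives; the
  -- directions `1` and `i` give the derivatives in `s` and `θ`.
  set k₂ := fun w => ζ₂ (Complex.exp w)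
  set k₃ := fun w => ζ₃ (Complex.exp w)
  set l₂ := fun w => deriv ζ₂ (Complex.exp w) * Complex.exp w with hl₂
  set l₃ := fun w => deriv ζ₃ (Complex.exp w) * Complex.exp w with hl₃
  set n₂ := fun w => deriv (deriv ζ₂) (Complex.exp w) * Complex.exp w * Complex.exp w
          + deriv ζ₂ (Complex.exp w) * Complex.exp w
  set n₃ := fun w => deriv (deriv ζ₃) (Complex.exp w) * Complex.exp w * Complex.exp w
          + deriv ζ₃ (Complex.exp w) * Complex.exp w
  refine le_circleAverage_of_laplacian_exp_nonneg hR
    (continuousOn_twisted hη h2.continuousOn h3.continuousOn)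
    (Gs := twistedD η k₂ k₃ l₂ l₃ 1) (Gss := twistedDD η k₂ k₃ l₂ l₃ n₂ n₃ 1)
    (Gθ := twistedD η k₂ k₃ l₂ l₃ Complex.I) (Gθθ := twistedDD η k₂ k₃ l₂ l₃ n₂ n₃ Complex.I)
    (fun s θ h => ?_) (fun s θ h => ?_) (fun s θ h => ?_) ?_ ?_ ?_ (fun s => ?_) (fun w hw => ?_)
  · exact hasDerivAt_twisted (k₂ := k₂) (k₃ := k₃) hη (hd1 _ h2 _ (hre s θ h))
      (hd1 _ h3 _ (hre s θ h)) (hγs s θ)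
  · exact hasDerivAt_twistedD hη (hd1 _ h2 _ (hre s θ h)) (hd1 _ h3 _ (hre s θ h))
      (hd2 _ h2 _ (hre s θ h)) (hd2 _ h3 _ (hre s θ h)) (hγs s θ)
  · exact hasDerivAt_twistedD (γ := fun θ : ℝ => (s : ℂ) + θ * Complex.I) hη
      (hd1 _ h2 _ (hre s θ h)) (hd1 _ h3 _ (hre s θ h))
      (hd2 _ h2 _ (hre s θ h)) (hd2 _ h3 _ (hre s θ h)) (hγθ s θ)
  · exact continuousOn_twistedD hη (c0 _ h2) (c0 _ h3) (c1 _ h2) (c1 _ h3)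
  · exact continuousOn_twistedDD hη (c0 _ h2) (c0 _ h3) (c1 _ h2) (c1 _ h3) (c2 _ h2) (c2 _ h3)
  · exact continuousOn_twistedDD hη (c0 _ h2) (c0 _ h3) (c1 _ h2) (c1 _ h3) (c2 _ h2) (c2 _ h3)
  · have e : Complex.exp (s + (2 * Real.pi : ℝ) * Complex.I)
        = Complex.exp (s + (0 : ℝ) * Complex.I) := by
      rw [Complex.exp_add, Complex.exp_add]
      push_cast
      rw [Complex.exp_two_pi_mul_I]; simp
    simp only [twistedD, rePair, k₂, k₃, l₂, l₃, e]
  · exact twistedDD_add_nonneg (hL _ (hmem w hw))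

/-! ### Pseudoconvexity -/

/-- Write `a + ζb = a(1 + ζ b/a)`. The only zero `-a/b` lies outside the ball, so `|ζ b/a| < 1` and
the principal logarithm applies to the second factor. -/
lemma exists_log_affine {R : ℝ} (hR : 0 < R) {a b : ℂ}
    (h : ∀ ζ ∈ Metric.ball (0 : ℂ) R, a + ζ * b ≠ 0) :
    ∃ l : ℂ → ℂ, DifferentiableOn ℂ l (Metric.ball 0 R) ∧
      ∀ ζ ∈ Metric.ball (0 : ℂ) R, Complex.exp (l ζ) = a + ζ * b := by
  have ha : a ≠ 0 := by simpa using h 0 (Metric.mem_ball_self hR)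
  have hlt : ∀ ζ ∈ Metric.ball (0 : ℂ) R, ‖ζ * (b / a)‖ < 1 := by
    intro ζ hζ
    by_contra! hge
    have hb : b ≠ 0 := by
      rintro rfl
      norm_num at hge
    refine h (-a / b) ?_ (by field_simp; ring)
    rw [mem_ball_zero_iff] at hζ ⊢
    refine lt_of_le_of_lt ?_ hζ
    rw [norm_mul, norm_div] at hge
    rw [norm_div, norm_neg, div_le_iff₀ (norm_pos_iff.2 hb)]
    rwa [mul_div_assoc', one_le_div (norm_pos_iff.2 ha)] at hge
  have hslit : ∀ ζ ∈ Metric.ball (0 : ℂ) R, 1 + ζ * (b / a) ∈ Complex.slitPlane := fun ζ hζ =>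
    Complex.mem_slitPlane_of_norm_lt_one (hlt ζ hζ)
  refine ⟨fun ζ => Complex.log a + Complex.log (1 + ζ * (b / a)), ?_, fun ζ hζ => ?_⟩
  · exact (differentiableOn_const _).add (DifferentiableOn.clog (by fun_prop) hslit)
  · rw [Complex.exp_add, Complex.exp_log ha,
      Complex.exp_log (Complex.slitPlane_ne_zero (hslit ζ hζ))]
    field_simp

/-- The key identity: `e^{2 Im (x+y)}` times the conjugate of the centre is the holomorphic function
`e^{-2i(x+y)}`, and the constant `-1` cancels against the squared norm of the centre. -/
lemma exp_mul_wormFn (η : ℝ × ℝ → ℝ) (z x y : ℂ) :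
    Real.exp (2 * (x.im + y.im)) * wormFn η (z, Complex.exp x, Complex.exp y) =
      ‖z * Complex.exp (-Complex.I * (x + y))‖ ^ 2
        - 2 * (z * Complex.exp (-2 * Complex.I * (x + y))).re
        + Real.exp (2 * (x.im + y.im)) * η (2 * x.re, 2 * y.re) := by
  have h1 : ‖z * Complex.exp (-Complex.I * (x + y))‖ ^ 2
      = Real.exp (2 * (x.im + y.im)) * ‖z‖ ^ 2 := by
    rw [norm_mul, mul_pow, Complex.norm_exp, ← Real.exp_nat_mul, mul_comm]
    congr 2
    simp
  have h2 : Complex.exp (-2 * Complex.I * (x + y)) = (Real.exp (2 * (x.im + y.im)) : ℂ) *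
      (starRingEnd ℂ) (Complex.exp (Complex.I * ((2 * (x.re + y.re) : ℝ) : ℂ))) := by
    rw [← Complex.exp_conj, Complex.ofReal_exp, ← Complex.exp_add]
    congr 1
    apply Complex.ext <;> simp
  have h3 : ‖z - wormCenter (z, Complex.exp x, Complex.exp y)‖ ^ 2 = ‖z‖ ^ 2
      - 2 * (z * (starRingEnd ℂ) (wormCenter (z, Complex.exp x, Complex.exp y))).re + 1 := by
    have hn := norm_wormCenter (z, Complex.exp x, Complex.exp y)
    set C := wormCenter (z, Complex.exp x, Complex.exp y)
    rw [← Complex.normSq_eq_norm_sq, Complex.normSq_sub, Complex.normSq_eq_norm_sq,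
      Complex.normSq_eq_norm_sq, hn]
    ring
  rw [wormFn, logPair_exp, h1, h2, h3, wormCenter_exp, mul_left_comm, Complex.re_ofReal_mul]
  ring

/-- The squared norm lies above its tangent at `w`, which is the real part of an affine holomorphic
function of `z`. -/
lemma norm_sq_tangent_le (z w : ℂ) :
    ‖w‖ ^ 2 + 2 * ((starRingEnd ℂ) w * (z - w)).re ≤ ‖z‖ ^ 2 := by
  rw [← Complex.normSq_eq_norm_sq, ← Complex.normSq_eq_norm_sq, Complex.normSq_apply,
    Complex.normSq_apply]
  simp only [Complex.mul_re, Complex.sub_re, Complex.sub_im, Complex.conj_re, Complex.conj_im]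
  nlinarith [sq_nonneg (z.re - w.re), sq_nonneg (z.im - w.im)]

lemma circleAverage_re_of_differentiableOn {H : ℂ → ℂ} {R : ℝ} (hR : 1 < R)
    (hH : DifferentiableOn ℂ H (Metric.ball 0 R)) :
    Real.circleAverage (fun ζ => (H ζ).re) 0 1 = (H 0).re := by
  have hsub : Metric.closedBall (0 : ℂ) 1 ⊆ Metric.ball 0 R := Metric.closedBall_subset_ball hR
  have hd : DiffContOnCl ℂ H (Metric.ball 0 |(1 : ℝ)|) := by
    rw [abs_one]
    exact DifferentiableOn.diffContOnCl (hH.mono ((Metric.closure_ball_subset_closedBall).trans hsub))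
  have hint : CircleIntegrable H 0 1 :=
    (hH.continuousOn.mono (Metric.sphere_subset_closedBall.trans hsub)).circleIntegrable zero_le_one
  have := Complex.reCLM.circleAverage_comp_comm hint
  rw [hd.circleAverage] at this
  exact this

/-- The function `-log (1 - η - |z₁ - e^{i log |z₂ z₃|²}|²)`. -/
def wormPotential (η : ℝ × ℝ → ℝ) (z : ℂ × ℂ × ℂ) : ℝ := -Real.log (-wormFn η z)

lemma continuousOn_wormPotential {η : ℝ × ℝ → ℝ} (hη : ContDiff ℝ ∞ η) :
    ContinuousOn (wormPotential η) (wormDomain η) := by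
  intro z hz
  obtain ⟨h2, h3, hr⟩ := mem_wormDomain.1 hz
  exact (((contDiffAt_wormFn hη h2 h3).continuousAt.neg.log
    (neg_ne_zero.2 hr.ne)).neg).continuousWithinAt

/-- On a disk, the potential is bounded below by `c T + Re H` with equality at the centre, where `H`
is holomorphic and `T` satisfies the sub-mean value inequality. The minorant comes from the tangent
lines of `-log` and of the squared norm. -/
lemma isContinuousPsh_wormPotential {η : ℝ × ℝ → ℝ} (hη : ContDiff ℝ ∞ η)
    (hL : ∀ t, η t < 1 → LeviNonneg η t) :
    IsContinuousPsh (wormDomain η) (wormPotential η) := by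
  refine ⟨continuousOn_wormPotential hη, fun a v hdisc => ?_⟩
  have hcont : Continuous fun ζ : ℂ => a + ζ • v := by fun_prop
  -- By compactness a slightly larger disk still maps into the domain, leaving room for holomorphic
  -- logarithms near the closed unit disk.
  obtain ⟨δ, hδ, hsub⟩ := (isCompact_closedBall (0 : ℂ) 1).exists_thickening_subset_open
    ((isOpen_wormDomain hη).preimage hcont) (fun ζ hζ => hdisc ζ (by simpa using hζ))
  rw [thickening_closedBall hδ zero_le_one] at hsub
  set R := δ + 1 with hR
  have hR1 : 1 < R := by linarith
  have hR0 : 0 < R := by linarith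
  have hmem : ∀ ζ ∈ Metric.ball (0 : ℂ) R, a + ζ • v ∈ wormDomain η := fun ζ hζ => hsub hζ
  obtain ⟨l₂, hd2, he2⟩ := exists_log_affine hR0 (a := a.2.1) (b := v.2.1)
    fun ζ hζ => (mem_wormDomain.1 (hmem ζ hζ)).1
  obtain ⟨l₃, hd3, he3⟩ := exists_log_affine hR0 (a := a.2.2) (b := v.2.2)
    fun ζ hζ => (mem_wormDomain.1 (hmem ζ hζ)).2.1
  have hz : ∀ ζ ∈ Metric.ball (0 : ℂ) R,
      a + ζ • v = (a.1 + ζ * v.1, Complex.exp (l₂ ζ), Complex.exp (l₃ ζ)) := fun ζ hζ => by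
    rw [he2 ζ hζ, he3 ζ hζ]; rfl
  set F : ℂ → ℂ := fun ζ => (a.1 + ζ * v.1) * Complex.exp (-Complex.I * (l₂ ζ + l₃ ζ)) with hF
  set E : ℂ → ℂ := fun ζ => (a.1 + ζ * v.1) * Complex.exp (-2 * Complex.I * (l₂ ζ + l₃ ζ)) with hE
  set T : ℂ → ℝ := twisted η l₂ l₃ with hT
  set ρ : ℂ → ℝ := fun ζ => ‖F ζ‖ ^ 2 - 2 * (E ζ).re + T ζ with hρ
  have hid : ∀ ζ ∈ Metric.ball (0 : ℂ) R,
      Real.exp (2 * ((l₂ ζ).im + (l₃ ζ).im)) * wormFn η (a + ζ • v) = ρ ζ := fun ζ hζ => by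
    rw [hz ζ hζ, exp_mul_wormFn]; rfl
  have hρneg : ∀ ζ ∈ Metric.ball (0 : ℂ) R, ρ ζ < 0 := fun ζ hζ => by
    rw [← hid ζ hζ]
    exact mul_neg_of_pos_of_neg (Real.exp_pos _) (mem_wormDomain.1 (hmem ζ hζ)).2.2
  have hu : ∀ ζ ∈ Metric.ball (0 : ℂ) R, wormPotential η (a + ζ • v)
      = -Real.log (-ρ ζ) + 2 * ((l₂ ζ).im + (l₃ ζ).im) := fun ζ hζ => by
    have hr := (mem_wormDomain.1 (hmem ζ hζ)).2.2
    rw [← hid ζ hζ, ← mul_neg, Real.log_mul (Real.exp_pos _).ne' (neg_pos.2 hr).ne', Real.log_exp,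
      wormPotential]
    ring
  have h0mem : (0 : ℂ) ∈ Metric.ball (0 : ℂ) R := Metric.mem_ball_self hR0
  -- `c` is the slope at `ρ 0` of the convex increasing function `ρ ↦ -log(-ρ)`, whose tangent there
  -- is `cρ + 1 + log c`.
  set c : ℝ := (-ρ 0)⁻¹ with hc
  have hc0 : 0 < c := inv_pos.2 (neg_pos.2 (hρneg 0 h0mem))
  -- `Re H` collects everything except `c T`: the linearised `|F|²`, the term in `E`, the constant
  -- of the tangent line, and the pluriharmonic correction `2 Im (l₂ + l₃)`.
  set H : ℂ → ℂ := fun ζ => (c : ℂ) * (((‖F 0‖ ^ 2 : ℝ) : ℂ)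
      + 2 * ((starRingEnd ℂ) (F 0) * (F ζ - F 0)) - 2 * E ζ)
      + ((1 + Real.log c : ℝ) : ℂ) + -2 * Complex.I * (l₂ ζ + l₃ ζ) with hH
  have hHre : ∀ ζ, (H ζ).re = c * (‖F 0‖ ^ 2 + 2 * ((starRingEnd ℂ) (F 0) * (F ζ - F 0)).re
      - 2 * (E ζ).re) + (1 + Real.log c) + 2 * ((l₂ ζ).im + (l₃ ζ).im) := fun ζ => by
    have e1 : ∀ w : ℂ, (2 * w).re = 2 * w.re := fun w => by simp
    have e2 : ∀ w : ℂ, (-2 * Complex.I * w).re = 2 * w.im := fun w => by simp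
    simp only [hH, Complex.add_re, Complex.re_ofReal_mul, Complex.sub_re, Complex.ofReal_re, e1, e2,
      Complex.add_im]
  have hFd : DifferentiableOn ℂ F (Metric.ball 0 R) := by rw [hF]; fun_prop
  have hEd : DifferentiableOn ℂ E (Metric.ball 0 R) := by rw [hE]; fun_prop
  have hHd : DifferentiableOn ℂ H (Metric.ball 0 R) := by rw [hH]; fun_prop
  have hTc : ContinuousOn T (Metric.ball 0 R) :=
    continuousOn_twisted hη hd2.continuousOn hd3.continuousOn
  have hsphere : Metric.sphere (0 : ℂ) 1 ⊆ Metric.ball 0 R :=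
    Metric.sphere_subset_closedBall.trans (Metric.closedBall_subset_ball hR1)
  have hTavg : T 0 ≤ Real.circleAverage T 0 1 := by
    refine twisted_le_circleAverage hη hR1 hd2 hd3 fun ζ hζ => hL _ ?_
    have := lt_one_of_mem_wormDomain (hmem ζ hζ)
    rwa [hz ζ hζ, logPair_exp] at this
  have hle : ∀ ζ ∈ Metric.ball (0 : ℂ) R,
      c * T ζ + (H ζ).re ≤ wormPotential η (a + ζ • v) := fun ζ hζ => by
    have h1 := neg_pos.2 (hρneg ζ hζ)
    have h2 := Real.log_le_sub_one_of_pos (mul_pos hc0 h1)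
    rw [Real.log_mul hc0.ne' h1.ne'] at h2
    have h3 := mul_le_mul_of_nonneg_left (norm_sq_tangent_le (F ζ) (F 0)) hc0.le
    rw [hu ζ hζ, hHre]
    have h4 : c * ρ ζ = c * ‖F ζ‖ ^ 2 - 2 * c * (E ζ).re + c * T ζ := by rw [hρ]; ring
    linarith
  have heq : wormPotential η a = c * T 0 + (H 0).re := by
    have h1 := hu 0 h0mem
    rw [zero_smul, add_zero] at h1
    have h2 : c * ρ 0 = -1 := by
      rw [hc, inv_neg, neg_mul, inv_mul_cancel₀ (hρneg 0 h0mem).ne]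
    have h3 : Real.log c = -Real.log (-ρ 0) := by rw [hc, Real.log_inv]
    have h4 : c * ρ 0 = c * ‖F 0‖ ^ 2 - 2 * c * (E 0).re + c * T 0 := by rw [hρ]; ring
    rw [h1, hHre, h3, sub_self, mul_zero, Complex.zero_re]
    linarith
  have hTi : CircleIntegrable T 0 1 := (hTc.mono hsphere).circleIntegrable zero_le_one
  have hHi : CircleIntegrable (fun ζ => (H ζ).re) 0 1 :=
    (Complex.continuous_re.comp_continuousOn (hHd.continuousOn.mono hsphere)).circleIntegrable
      zero_le_one
  have hui : CircleIntegrable (fun ζ => wormPotential η (a + ζ • v)) 0 1 :=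
    ((continuousOn_wormPotential hη).comp hcont.continuousOn
      fun ζ hζ => hmem ζ (hsphere hζ)).circleIntegrable zero_le_one
  have hcTi : CircleIntegrable (fun ζ => c • T ζ) 0 1 := hTi.const_smul
  calc wormPotential η a = c * T 0 + (H 0).re := heq
    _ ≤ c * Real.circleAverage T 0 1 + Real.circleAverage (fun ζ => (H ζ).re) 0 1 := by
        rw [circleAverage_re_of_differentiableOn hR1 hHd]
        gcongr
    _ = Real.circleAverage (fun ζ => c • T ζ + (H ζ).re) 0 1 := by
        rw [Real.circleAverage_fun_add hcTi hHi, Real.circleAverage_fun_smul, smul_eq_mul]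
    _ ≤ Real.circleAverage (fun ζ => wormPotential η (a + ζ • v)) 0 1 := by
        refine Real.circleAverage_mono (hcTi.add hHi) hui fun ζ hζ => hle ζ (hsphere ?_)
        rwa [abs_one] at hζ

lemma isPseudoconvex_wormDomain {η : ℝ × ℝ → ℝ} (hη : ContDiff ℝ ∞ η) (h0 : ∀ t, 0 ≤ η t) {M : ℝ}
    (hM : ∀ t, η t < 1 → |t.1| ≤ M ∧ |t.2| ≤ M) (hL : ∀ t, η t < 1 → LeviNonneg η t) :
    IsPseudoconvex (wormDomain η) := by
  refine ⟨isOpen_wormDomain hη, wormPotential η, isContinuousPsh_wormPotential hη hL, fun c => ?_⟩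
  -- A sublevel set of the potential is `{r ≤ -e^{-c}}` inside the box, a description by closed
  -- conditions away from the axes, hence compact.
  have e : {z ∈ wormDomain η | wormPotential η z ≤ c}
      = {z ∈ logBox M | wormFn η z ≤ -Real.exp (-c)} := by
    ext z
    constructor
    · rintro ⟨hz, hc⟩
      have hr := (mem_wormDomain.1 hz).2.2
      refine ⟨wormDomain_subset_logBox hM hz, ?_⟩
      unfold wormPotential at hc
      have := (Real.le_log_iff_exp_le (neg_pos.2 hr)).1 (by linarith : -c ≤ Real.log (-wormFn η z))
      linarith
    · rintro ⟨hz, hc⟩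
      have hpos := Real.exp_pos (-c)
      have hr : wormFn η z < 0 := by linarith
      refine ⟨mem_wormDomain.2
        ⟨(ne_zero_of_mem_logBox hz).1, (ne_zero_of_mem_logBox hz).2, hr⟩, ?_⟩
      have := (Real.le_log_iff_exp_le (neg_pos.2 hr)).2 (by linarith : Real.exp (-c) ≤ _)
      unfold wormPotential
      linarith
  rw [e]
  refine Metric.isCompact_of_isClosed_isBounded (isClosed_logBox_inter hη M _)
    ((isBounded_logBox_inter h0 M).subset fun z hz => ⟨hz.1, hz.2.trans ?_⟩)
  linarith [Real.exp_pos (-c)]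

lemma isPseudoconvex_wormEta {μ Ap Am Bp Bm cp cm : ℝ} (hp : WormParams μ Ap Bp)
    (hm : WormParams μ Am Bm) (hcp : levelBound (2 * Ap ^ 2) (2 * Am ^ 2) ≤ cp)
    (hcm : levelBound (2 * Am ^ 2) (2 * Ap ^ 2) ≤ cm) (hcp0 : 0 < cp) (hcm0 : 0 < cm) :
    IsPseudoconvex (wormDomain (wormEta Ap Am Bp Bm cp cm)) :=
  isPseudoconvex_wormDomain (contDiff_wormEta hcp0 hcm0) (wormEta_nonneg hcp0 hcm0)
    (fun _ ht => (abs_lt_of_wormEta_lt_one hp hm hcp0 hcm0 (le_max_left _ _) (le_max_right _ _)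
      ht).imp le_of_lt le_of_lt)
    (fun _ ht => leviNonneg_wormEta hp hm hcp hcm (mem_wormRegion_of_le_one hp hm hcp0 hcm0 ht.le))

end

/-! ### Assembly. -/

theorem mainTheorem1 (μ : ℝ) (hμ : Real.pi < μ) :
    (∀ Ap Am Bp Bm : ℝ,
      Real.sqrt (2 * Real.exp μ) ≤ Bp → Bp < Ap →
      Real.sqrt (2 * Real.exp μ) ≤ Bm → Bm < Am →
      (∀ cp cm : ℝ, 0 < cp → 0 < cm →
        IsWormProfile μ (wormEta Ap Am Bp Bm cp cm) ∧
        IsSmoothlyBoundedDomain (wormDomain (wormEta Ap Am Bp Bm cp cm)) ∧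
        truncatedWorm μ ⊆ wormDomain (wormEta Ap Am Bp Bm cp cm) ∧
        ∀ μ' : ℝ, 2 * Real.log Ap ≤ μ' → 2 * Real.log Am ≤ μ' →
          wormDomain (wormEta Ap Am Bp Bm cp cm) ⊆ truncatedWorm μ') ∧
      (∃ Cp : ℝ, Ap ^ 2 ≤ Cp ∧ ∀ cp : ℝ, Cp < cp →
        ∃ Cm : ℝ, Am ^ 2 ≤ Cm ∧ ∀ cm : ℝ, Cm < cm →
          IsPseudoconvex (wormDomain (wormEta Ap Am Bp Bm cp cm)) ∧
          wormDomain (wormEta Ap Am Bp Bm cp cm) ∈ wormClass μ)) ∧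
    (wormClass μ).Nonempty := by
  have hμ0 : 0 < μ := Real.pi_pos.trans hμ
  have hbound : ∀ {K L : ℝ}, 0 < K → K ^ 2 ≤ levelBound (2 * K ^ 2) L := fun {K L} hK => by
    have : 0 ≤ (2 * K ^ 2) ^ 3 * L ^ 2 := by positivity
    unfold levelBound
    nlinarith [sq_nonneg K]
  have hpos : ∀ {K L c : ℝ}, 0 < K → levelBound (2 * K ^ 2) L < c → 0 < c := fun hK h =>
    (pow_pos hK 2).trans_le ((hbound hK).trans h.le)
  have hclass : ∀ Ap Am Bp Bm : ℝ, WormParams μ Ap Bp → WormParams μ Am Bm →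
      ∃ Cp : ℝ, Ap ^ 2 ≤ Cp ∧ ∀ cp : ℝ, Cp < cp → ∃ Cm : ℝ, Am ^ 2 ≤ Cm ∧ ∀ cm : ℝ, Cm < cm →
          IsPseudoconvex (wormDomain (wormEta Ap Am Bp Bm cp cm)) ∧
          wormDomain (wormEta Ap Am Bp Bm cp cm) ∈ wormClass μ := fun Ap Am Bp Bm hp hm =>
    -- The arguments `2A₊²` and `2A₋²` bound the exponential sums on `wormRegion`. The threshold for
    -- `c₋` does not depend on `c₊`.
    ⟨levelBound (2 * Ap ^ 2) (2 * Am ^ 2), hbound hp.pos, fun cp hcp =>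
      ⟨levelBound (2 * Am ^ 2) (2 * Ap ^ 2), hbound hm.pos, fun cm hcm =>
        ⟨isPseudoconvex_wormEta hp hm hcp.le hcm.le (hpos hp.pos hcp) (hpos hm.pos hcm),
          wormDomain_mem_wormClass hμ0 hp hm hcp.le hcm.le (hpos hp.pos hcp) (hpos hm.pos hcm)⟩⟩⟩
  refine ⟨fun Ap Am Bp Bm hBp hAp hBm hAm => ?_, ?_⟩
  · have hp := WormParams.of_sqrt_le hBp hAp
    have hm := WormParams.of_sqrt_le hBm hAm
    exact ⟨fun cp cm hcp hcm => ⟨isWormProfile_wormEta hμ0 hp hm hcp hcm,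
      isSmoothlyBoundedDomain_wormEta hμ0 hp hm hcp hcm,
      truncatedWorm_subset_wormDomain hp hm hcp hcm,
      fun _ h1 h2 => wormDomain_subset_truncatedWorm hp hm hcp hcm h1 h2⟩,
      hclass Ap Am Bp Bm hp hm⟩
  -- For nonemptiness both signs take the smallest allowed `B` and `A = B + 1`.
  · have hp : WormParams μ (Real.sqrt (2 * Real.exp μ) + 1) (Real.sqrt (2 * Real.exp μ)) :=
      WormParams.of_sqrt_le le_rfl (lt_add_one _)
    obtain ⟨Cp, -, h⟩ := hclass _ _ _ _ hp hp
    obtain ⟨Cm, -, h'⟩ := h (Cp + 1) (lt_add_one _)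
    exact ⟨_, (h' (Cm + 1) (lt_add_one _)).2⟩
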